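/- **Setting.** Let $G$ be a finite group and let $X$ be a finite undirected $d$-regular graph ($d\ge 1$; loops and parallel edges allowed) on $N$ vertices $V$, with degree-normalized adjacency matrix $A_X$ and eigenvalues $\lambda_1\ge\lambda_2\ge\dots\ge\lambda_N$. For $\lambda\ge 0$, $X$ is a $\lambda$-expander if $|\lambda_2|,\dots,|\lambda_N|\le\lambda$. A labeling $\varphi:V\to G$ is unbiased if $\varphi(v)$ is uniform on $G$ for uniform $v\in V$. $X$ is pseudo-Cayley with respect to $G$, with labeling $\varphi$, if $\varphi$ is unbiased and for every irreducible unitary representation $\rho$ of $G$ there is $\lambda_\rho$ such that all the functions $\rho_{ij}\circ\varphi$ are eigenvectors of $A_X$ with eigenvalue $\lambda_\rho$. For $f:G^n\to\mathbb C$ put $$\mathcal E_X(f)=\mathbb E_{\vec x\sim \mathrm{RW}_n}\big[f(\varphi(x_1),\dots,\varphi(x_n))\big]-\mathbb E_{\vec x\sim V^n}\big[f(\varphi(x_1),\dots,\varphi(x_n))\big],$$ where $\mathrm{RW}_n$ is the random walk on $X$ with $n$ vertices started at a uniform vertex, and in the second term $\vec x$ is uniform on $V^n$. Let $\|f\|_2=(\mathbb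 E_{\vec g\in G^n}|f(\vec g)|^2)^{1/2}$. The function $f$ is symmetric if it is invariant under permuting its $n$ arguments, and a class function if $f(g_1x_1g_1^{-1},\dots,g_nx_ng_n^{-1})=f(x_1,\dots,x_n)$ for all $\vec g,\vec x\in G^n$. For an integer $D\ge1$, $G$ is $D$-quasirandom if every non-trivial irreducible representation of $G$ has dimension at least $D$. **Proposition.** There is an absolute constant $C>0$ such that the following holds for all $n$ and all $\lambda\ge0$ with $\lambda\sqrt{|G|}\le\frac1{16e}$. 1. If $G$ is $D$-quasirandom, $X$ is a pseudo-Cayley $\lambda$-expander with respect to $G$, and $f:G^n\to\mathbb C$ is a symmetric class function, then $$|\mathcal E_X(f)|\le C\,\frac{\sqrt{|G|}}{D}\,\lambda\,\|f\|_2 .$$ 2. In particular, if $G$ is abelian and $X$ is a pseudo-Cayley $\lambda$-expander with respect to $G$, then every symmetric $f:G^n\to\mathbb C$ satisfies $|\mathcal E_X(f)|\le C\sqrt{|G|}\,\lambda\,\|f\|_2$. 3. The bound in 2 holds in particular if $G$ is abelian and $X=\mathrm{Cay}(G,S)$ is a $\lambda$-expander with the identity labeling, where $S$ is a non-empty multiset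 of elements of $G$ closed under inversion. -/

import Mathlib

universe u v

namespace ExpanderWalk

/-- A finite undirected regular graph of positive degree on the vertex set `V`. Loops and parallel
edges are allowed: `adj x y` is the number of edges from `x` to `y`, and every vertex has exactly
`deg` outgoing edge ends. -/
structure RegularGraph (V : Type*) [Fintype V] where
  deg : ℕ
  deg_pos : 0 < deg
  adj : Matrix V V ℕ
  symm : ∀ x y, adj x y = adj y x
  regular : ∀ x, ∑ y, adj x y = deg

namespace RegularGraph

variable {V : Type*} [Fintype V]

/-- The degree-normalized adjacency matrix `A_X`; its entries are the transition probabilities of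
the random walk on `X`. -/
noncomputable def normAdj (X : RegularGraph V) : Matrix V V ℂ :=
  fun x y => (X.adj x y : ℂ) / (X.deg : ℂ)

theorem normAdj_isHermitian (X : RegularGraph V) : X.normAdj.IsHermitian := by
  ext x y
  simp [normAdj, Matrix.conjTranspose_apply, X.symm x y]

open Classical in
/-- The eigenvalues of `A_X`, with multiplicity, in decreasing order; `X.eigenvalue 0` is the
largest one, the eigenvalue `1` of the constant functions. -/
noncomputable def eigenvalue (X : RegularGraph V) : Fin (Fintype.card V) → ℝ :=
  X.normAdj_isHermitian.eigenvalues₀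

/-- `X` is a `lam`-expander: with `λ₁ ≥ λ₂ ≥ ⋯ ≥ λ_N` the eigenvalues of `A_X`, all of
`|λ₂|, …, |λ_N|` are at most `lam`; equivalently `max (|λ₂|, |λ_N|) ≤ lam`. -/
def IsExpander (X : RegularGraph V) (lam : ℝ) : Prop :=
  ∀ i : Fin (Fintype.card V), 0 < i.val → |X.eigenvalue i| ≤ lam

/-- The probability that the stationary random walk with `n` vertices (a uniform first vertex,
then `n - 1` independent uniformly random edges) is the sequence `x`. -/
noncomputable def walkProb (X : RegularGraph V) : {n : ℕ} → (Fin n → V) → ℂ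
  | 0, _ => 1
  | m + 1, x => (1 / (Fintype.card V : ℂ)) * ∏ i : Fin m, X.normAdj (x i.castSucc) (x i.succ)

/-- `𝓔_X(F)` for a function `F` of `n` vertices: the mean of `F` over the random walk with `n`
vertices, minus the mean of `F` over `n` independent uniform vertices. -/
noncomputable def walkError (X : RegularGraph V) {n : ℕ} (F : (Fin n → V) → ℂ) : ℂ :=
  (∑ x : Fin n → V, X.walkProb x * F x)
    - (1 / (Fintype.card V : ℂ) ^ n) * ∑ x : Fin n → V, F x

end RegularGraph

section Groups

variable {G : Type*} [Group G]

/-- The representation of `G` on `ℂ^d` given by a homomorphism into the unitary group. -/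
noncomputable def toRep {d : ℕ} (ρ : G →* Matrix.unitaryGroup (Fin d) ℂ) :
    Representation ℂ G (Fin d → ℂ) where
  toFun g := Matrix.toLin' (ρ g : Matrix (Fin d) (Fin d) ℂ)
  map_one' := by simp [Module.End.one_eq_id]
  map_mul' g h := by simp [Matrix.toLin'_mul, Module.End.mul_eq_comp]

/-- `ρ` is an irreducible unitary representation. -/
def IsIrrep {d : ℕ} (ρ : G →* Matrix.unitaryGroup (Fin d) ℂ) : Prop :=
  (toRep ρ).IsIrreducible

/-- `G` is `D`-quasirandom: every irreducible representation other than the trivial one has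
dimension at least `D`. -/
def IsQuasirandom (G : Type*) [Group G] (D : ℕ) : Prop :=
  ∀ (d : ℕ) (ρ : G →* Matrix.unitaryGroup (Fin d) ℂ), IsIrrep ρ → ρ ≠ 1 → D ≤ d

/-- A labeling `φ : V → G` is unbiased if a uniform vertex has a uniform label. -/
def IsUnbiased {V : Type*} [Fintype V] [Fintype G] (φ : V → G) : Prop :=
  ∀ g : G, (Nat.card {x : V // φ x = g} : ℝ) / Fintype.card V = 1 / Fintype.card G

/-- `X` is pseudo-Cayley with respect to `G`, witnessed by the labeling `φ`: the labeling is
unbiased, and for every irreducible unitary `ρ` there is `μ = λ_ρ` such that all matrix entries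
`ρ_{ij} ∘ φ` are eigenvectors of `A_X` with eigenvalue `μ`. (These functions are non-zero by Schur
orthogonality. Equivalent representations have entries with the same span, so it makes no
difference that `ρ` runs over all irreducible representations and not over a set of
representatives.) -/
def IsPseudoCayley {V : Type*} [Fintype V] [Fintype G] (X : RegularGraph V) (φ : V → G) : Prop :=
  IsUnbiased φ ∧
    ∀ (d : ℕ) (ρ : G →* Matrix.unitaryGroup (Fin d) ℂ), IsIrrep ρ →
      ∃ μ : ℂ, ∀ i j : Fin d,
        X.normAdj.mulVec (fun v => (ρ (φ v) : Matrix (Fin d) (Fin d) ℂ) i j)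
          = μ • (fun v => (ρ (φ v) : Matrix (Fin d) (Fin d) ℂ) i j)

/-- `f : G^n → ℂ` is a class function of the group `G^n`. -/
def IsClassFunction {n : ℕ} (f : (Fin n → G) → ℂ) : Prop :=
  ∀ g x : Fin n → G, f (fun i => g i * x i * (g i)⁻¹) = f x

/-- `f : G^n → ℂ` is invariant under all permutations of the coordinates. -/
def IsSymmetricFunction {n : ℕ} (f : (Fin n → G) → ℂ) : Prop :=
  ∀ (σ : Equiv.Perm (Fin n)) (x : Fin n → G), f (x ∘ σ) = f x

/-- The normalized norm `‖f‖₂ = (𝔼_{x ∈ G^n} |f x|²)^{1/2}`. -/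
noncomputable def l2Norm [Fintype G] {n : ℕ} (f : (Fin n → G) → ℂ) : ℝ :=
  Real.sqrt ((1 / (Fintype.card G : ℝ) ^ n) * ∑ x : Fin n → G, ‖f x‖ ^ 2)

open Classical in
/-- The Cayley graph `Cay(G, S)` of a non-empty multiset `S` closed under inversion: the edges at
`x` go to `x * s`, for `s` in `S`. -/
noncomputable def cayley [Fintype G] (S : Multiset G) (hS : S ≠ 0)
    (hinv : S.map (fun s => s⁻¹) = S) : RegularGraph G where
  deg := S.card
  deg_pos := Multiset.card_pos.mpr hS
  adj := fun x y => S.count (x⁻¹ * y)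
  symm := fun x y => by
    have h := Multiset.count_map_eq_count' (fun s : G => s⁻¹) S inv_injective (x⁻¹ * y)
    rw [hinv] at h
    simpa using h.symm
  regular := fun x => by
    have h := Fintype.sum_equiv (Equiv.mulLeft x⁻¹) (fun y => S.count (x⁻¹ * y))
      (fun z => S.count z) (fun y => rfl)
    exact h.trans (Multiset.sum_count_eq_card fun a _ => Finset.mem_univ a)

end Groups

end ExpanderWalk

open ExpanderWalk

namespace ExpanderWalk

open scoped ComplexConjugate

/-! ### Sums over binary patterns -/

/-! Expand `f` in tensor products of an orthonormal basis of the class functions on `G` whose first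
member is `1`, and group the terms by the pattern `s` of coordinates carrying a non-constant basis
function. The all-constant term has the same mean under both distributions; every other tensor has
mean zero under independent sampling. So the error is the sum, over non-zero patterns, of
coefficients times walk means.

For each pattern, Cauchy-Schwarz separates these two factors. By symmetry all patterns of weight `k`
carry equal coefficient mass, hence at most `‖f‖₂² / n.choose k` each. The walk means are bounded in
`walkVector_bound` by following the constant and the orthogonal part of a vector along the walk, for
all tensors of one pattern at once. With `ε = lam * √|G|` this gives the recursion `patternBound`,
with an additional factor `1 / D`: by `IsQuasirandom.finrank_zeroSumClassFunctions_mul_sq_le` there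
are at most `|G| / D ^ 2` non-constant basis functions.

It remains to sum the recursion. The generating function in `sum_patternBound_mul_pow_le` bounds the
total over weight `k` by about `√((4eε) ^ k * n.choose k)`, so the binomial coefficient cancels
against the symmetry gain. Weight one contributes nothing, and a geometric series from weight two on
gives a bound linear in `ε`. -/

theorem sum_fin_succ_fun {α M : Type*} [Fintype α] [AddCommMonoid M] {n : ℕ}
    (F : (Fin (n + 1) → α) → M) :
    ∑ x, F x = ∑ a, ∑ y : Fin n → α, F (Fin.cons a y) := by
  rw [← Fintype.sum_prod_type' (f := fun a y => F (Fin.cons a y))]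
  exact (Fintype.sum_equiv (Fin.consEquiv (fun _ : Fin (n + 1) => α)) _ _ (fun _ => rfl)).symm

/-- The number of `true` entries of a pattern. -/
def weight {n : ℕ} (s : Fin n → Bool) : ℕ := ∑ i, (s i).toNat

@[simp] theorem weight_cons {n : ℕ} (b : Bool) (s : Fin n → Bool) :
    weight (Fin.cons b s : Fin (n + 1) → Bool) = b.toNat + weight s := by
  simp [weight, Fin.sum_univ_succ]

theorem weight_le {n : ℕ} (s : Fin n → Bool) : weight s ≤ n := by
  unfold weight
  refine (Finset.sum_le_sum (fun i _ => Bool.toNat_le (s i))).trans ?_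
  simp

/-- For a pattern `s`, a bound for the constant part and for the part orthogonal to the constants
of the vector obtained by running a random walk along `s`. -/
noncomputable def patternBound (lam ε : ℝ) : (n : ℕ) → (Fin n → Bool) → ℝ × ℝ
  | 0, _ => (1, 0)
  | n + 1, s =>
    let p := patternBound lam ε n (Fin.tail s)
    if s 0 then (p.2, ε * (p.1 + p.2)) else (p.1, lam * p.2)

@[simp] theorem patternBound_zero (lam ε : ℝ) (s : Fin 0 → Bool) :
    patternBound lam ε 0 s = (1, 0) := rfl

@[simp] theorem patternBound_cons_true (lam ε : ℝ) {n : ℕ} (s : Fin n → Bool) :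
    patternBound lam ε (n + 1) (Fin.cons true s) =
      ((patternBound lam ε n s).2,
        ε * ((patternBound lam ε n s).1 + (patternBound lam ε n s).2)) := by
  simp [patternBound]

@[simp] theorem patternBound_cons_false (lam ε : ℝ) {n : ℕ} (s : Fin n → Bool) :
    patternBound lam ε (n + 1) (Fin.cons false s) =
      ((patternBound lam ε n s).1, lam * (patternBound lam ε n s).2) := by
  simp [patternBound]

theorem patternBound_nonneg {lam ε : ℝ} (hl : 0 ≤ lam) (hε : 0 ≤ ε) {n : ℕ} (s : Fin n → Bool) :
    0 ≤ (patternBound lam ε n s).1 ∧ 0 ≤ (patternBound lam ε n s).2 := by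
  induction n with
  | zero => simp
  | succ n ih =>
    obtain ⟨h1, h2⟩ := ih (Fin.tail s)
    rw [← Fin.cons_self_tail s]
    cases s 0 <;> simp <;> constructor <;> positivity

/-- Mirrors the fact that a single mean-zero factor still has mean zero along a stationary walk.
Dropping weight one is what makes the final bound linear in `ε` instead of of order `√ε`. -/
theorem patternBound_of_weight_le_one (lam ε : ℝ) {n : ℕ} (s : Fin n → Bool) :
    (weight s = 0 → (patternBound lam ε n s).2 = 0) ∧
      (weight s = 1 → (patternBound lam ε n s).1 = 0) := by
  induction n with
  | zero => simp [weight]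
  | succ n ih =>
    obtain ⟨h1, h2⟩ := ih (Fin.tail s)
    rw [← Fin.cons_self_tail s]
    cases s 0
    · simp only [weight_cons, patternBound_cons_false, Bool.toNat_false, zero_add]
      exact ⟨fun h => by simp [h1 h], h2⟩
    · simp only [weight_cons, patternBound_cons_true, Bool.toNat_true]
      exact ⟨fun h => by omega, fun h => h1 (by omega)⟩

/-- Serves the degenerate case `ε = 0`, where the optimal `z` below would require division by zero.
-/
theorem patternBound_zero_zero {n : ℕ} (s : Fin n → Bool) :
    (patternBound 0 0 n s).2 = 0 ∧ (weight s ≠ 0 → (patternBound 0 0 n s).1 = 0) := by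
  induction n with
  | zero => simp [weight]
  | succ n ih =>
    obtain ⟨h1, h2⟩ := ih (Fin.tail s)
    rw [← Fin.cons_self_tail s]
    cases s 0 <;> simp_all

/-- A potential argument: for a pair `(a, b)`, the two values of the next bit together turn `a +
2zb` into `(1 + 2z²ε)a + zb(1 + 2zε + 2lam)`. The hypothesis makes the last bracket at most `2`, so
the potential grows by at most `1 + 2z²ε`. -/
theorem sum_patternBound_mul_pow_le {lam ε z : ℝ} (hl : 0 ≤ lam) (hε : 0 ≤ ε) (hz : 0 ≤ z)
    (h : lam + z * ε ≤ 1 / 2) (n : ℕ) :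
    ∑ s : Fin n → Bool, z ^ weight s *
        ((patternBound lam ε n s).1 + 2 * z * (patternBound lam ε n s).2)
      ≤ (1 + 2 * z ^ 2 * ε) ^ n := by
  induction n with
  | zero => simp [weight]
  | succ n ih =>
    rw [sum_fin_succ_fun, Fintype.sum_bool, ← Finset.sum_add_distrib, pow_succ']
    refine le_trans ?_ (mul_le_mul_of_nonneg_left ih (by positivity))
    rw [Finset.mul_sum]
    refine Finset.sum_le_sum fun s _ => ?_
    obtain ⟨h1, h2⟩ := patternBound_nonneg hl hε s
    simp only [weight_cons, patternBound_cons_false, patternBound_cons_true, Bool.toNat_true,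
      Bool.toNat_false, zero_add, pow_add, pow_one]
    generalize (patternBound lam ε n s).1 = a at *
    generalize (patternBound lam ε n s).2 = b at *
    have hw : 0 ≤ z ^ weight s := by positivity
    generalize z ^ weight s = w at *
    have key : 0 ≤ w * (z * b) * (1 - 2 * (z * ε) - 2 * lam) :=
      mul_nonneg (by positivity) (by linarith)
    have key2 : 0 ≤ w * (4 * z ^ 3 * ε * b) := by positivity
    nlinarith

/-! ### Extracting the contribution of one weight -/

theorem pow_le_pow_mul_choose {n k : ℕ} (h : k ≤ n) : n ^ k ≤ k ^ k * n.choose k := by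
  induction k generalizing n with
  | zero => simp
  | succ k ih =>
    obtain ⟨m, rfl⟩ : ∃ m, n = m + 1 := ⟨n - 1, by omega⟩
    have hk : k ≤ m := by omega
    have h0 : 0 < k ^ k := by rcases k with _ | k <;> simp
    refine Nat.le_of_mul_le_mul_right ?_ h0
    have h1 : (m + 1) ^ k * k ^ k ≤ (k + 1) ^ k * m ^ k := by
      rw [← mul_pow, ← mul_pow]
      exact Nat.pow_le_pow_left (by nlinarith) _
    have h2 := Nat.add_one_mul_choose_eq m k
    calc (m + 1) ^ (k + 1) * k ^ k = (m + 1) * ((m + 1) ^ k * k ^ k) := by ring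
      _ ≤ (m + 1) * ((k + 1) ^ k * m ^ k) := Nat.mul_le_mul_left _ h1
      _ ≤ (m + 1) * ((k + 1) ^ k * (k ^ k * m.choose k)) := by gcongr; exact ih hk
      _ = (k + 1) ^ k * k ^ k * ((m + 1) * m.choose k) := by ring
      _ = (k + 1) ^ (k + 1) * (m + 1).choose (k + 1) * k ^ k := by rw [h2]; ring

theorem exp_one_mul_le_of_le {ε : ℝ} (h : ε ≤ 1 / (16 * Real.exp 1)) :
    4 * Real.exp 1 * ε ≤ 1 / 4 := by
  have := Real.exp_pos 1
  rw [le_div_iff₀ (by positivity)] at h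
  linarith

/-- A Chernoff-type argument: keep only the weight-`k` terms of the generating function and divide
by `z ^ k`. -/
theorem sq_sum_patternBound_le {lam ε : ℝ} (hl : 0 ≤ lam) (hle : lam ≤ ε) (hε : 0 < ε)
    (h : ε ≤ 1 / (16 * Real.exp 1)) {n k : ℕ} (hk : 0 < k) (hkn : k ≤ n) :
    (∑ s : Fin n → Bool with weight s = k, (patternBound lam ε n s).1) ^ 2
      ≤ (4 * Real.exp 1 * ε) ^ k * n.choose k := by
  have he := Real.add_one_le_exp (1 : ℝ)
  have h4 := exp_one_mul_le_of_le h
  have hε' : ε ≤ 1 / 32 := by nlinarith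
  have hn : (0 : ℝ) < n := by exact_mod_cast hk.trans_le hkn
  have hk' : (0 : ℝ) < k := by exact_mod_cast hk
  have hkn' : (k : ℝ) ≤ n := by exact_mod_cast hkn
  -- With this `z`, `2z²ε = k / (2n)`, so the bound becomes `exp (k / 2)`; moreover `z * ε ≤ 1 / 4`,
  -- which leaves room for `lam`.
  set z : ℝ := Real.sqrt (k / (4 * n * ε)) with hz
  have hz2 : z ^ 2 = k / (4 * n * ε) := Real.sq_sqrt (by positivity)
  have hz0 : 0 < z := Real.sqrt_pos.mpr (by positivity)
  have hzε : z * ε ≤ 1 / 4 := by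
    refine abs_le_of_sq_le_sq' ?_ (by norm_num) |>.2
    rw [mul_pow, hz2]
    have : k / (4 * n * ε) * ε ^ 2 = (k / n) * (ε / 4) := by field_simp
    rw [this]
    have h1 : (k : ℝ) / n ≤ 1 := (div_le_one hn).mpr hkn'
    nlinarith
  have hsum := sum_patternBound_mul_pow_le hl hε.le hz0.le (by linarith) n
  set a := ∑ s : Fin n → Bool with weight s = k, (patternBound lam ε n s).1 with ha
  have ha0 : 0 ≤ a := Finset.sum_nonneg fun s _ => (patternBound_nonneg hl hε.le s).1
  have h1 : z ^ k * a ≤ (1 + 2 * z ^ 2 * ε) ^ n := by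
    refine le_trans ?_ hsum
    rw [ha, Finset.mul_sum]
    refine le_trans (Finset.sum_le_sum (g := fun s => z ^ weight s *
      ((patternBound lam ε n s).1 + 2 * z * (patternBound lam ε n s).2)) fun s hs => ?_)
      (Finset.sum_le_sum_of_subset_of_nonneg (Finset.subset_univ _) fun s _ _ => ?_)
    · rw [(Finset.mem_filter.mp hs).2]
      have := (patternBound_nonneg hl hε.le s).2
      gcongr
      nlinarith
    · obtain ⟨p, q⟩ := patternBound_nonneg hl hε.le s
      positivity
  have h2 : (1 + 2 * z ^ 2 * ε) ^ n ≤ Real.exp (k / 2) := by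
    have e1 : 2 * z ^ 2 * ε = k / (2 * n) := by rw [hz2]; field_simp; ring
    have := Real.add_one_le_exp (2 * z ^ 2 * ε)
    calc (1 + 2 * z ^ 2 * ε) ^ n ≤ Real.exp (2 * z ^ 2 * ε) ^ n := by
          gcongr; linarith
      _ = Real.exp (k / 2) := by
          rw [← Real.exp_nat_mul, e1]; congr 1; field_simp
  have h3 : (z ^ k * a) ^ 2 ≤ Real.exp 1 ^ k := by
    calc (z ^ k * a) ^ 2 ≤ Real.exp (k / 2) ^ 2 := by
          gcongr; exact h1.trans h2
      _ = Real.exp 1 ^ k := by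
          rw [← Real.exp_nat_mul, ← Real.exp_nat_mul]; congr 1; push_cast; ring
  have h4 : a ^ 2 ≤ (4 * n * ε / k) ^ k * Real.exp 1 ^ k := by
    have e2 : (4 * n * ε / k) ^ k * (z ^ 2) ^ k = 1 := by
      rw [hz2, ← mul_pow]
      have : 4 * n * ε / k * (k / (4 * n * ε)) = 1 := by field_simp
      rw [this, one_pow]
    calc a ^ 2 = (4 * n * ε / k) ^ k * (z ^ k * a) ^ 2 := by
          rw [mul_pow, ← pow_mul, mul_comm k 2, pow_mul, ← mul_assoc, e2, one_mul]
      _ ≤ _ := by gcongr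
  refine h4.trans ?_
  have h5 : ((n : ℝ) / k) ^ k ≤ n.choose k := by
    rw [div_pow, div_le_iff₀ (by positivity), mul_comm]
    exact_mod_cast pow_le_pow_mul_choose hkn
  calc (4 * n * ε / k) ^ k * Real.exp 1 ^ k
      = (4 * Real.exp 1 * ε) ^ k * ((n : ℝ) / k) ^ k := by
        rw [← mul_pow, ← mul_pow]; congr 1; ring
    _ ≤ _ := by gcongr

theorem sum_patternBound_div_sqrt_choose_le {lam ε : ℝ} (hl : 0 ≤ lam) (hle : lam ≤ ε)
    (h : ε ≤ 1 / (16 * Real.exp 1)) (n : ℕ) :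
    ∑ s : Fin n → Bool with weight s ≠ 0,
        (patternBound lam ε n s).1 / Real.sqrt (n.choose (weight s))
      ≤ 32 * Real.exp 1 * ε := by
  rcases (hl.trans hle).eq_or_lt with h0 | hε
  · subst h0
    obtain rfl : lam = 0 := le_antisymm hle hl
    rw [Finset.sum_eq_zero]
    · simp
    · intro s hs
      rw [(patternBound_zero_zero s).2 (Finset.mem_filter.mp hs).2, zero_div]
  have h4 := exp_one_mul_le_of_le h
  have he := Real.exp_pos 1
  have hfib : ∑ s : Fin n → Bool with weight s ≠ 0,
        (patternBound lam ε n s).1 / Real.sqrt (n.choose (weight s))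
      = ∑ k ∈ Finset.Icc 1 n,
        (∑ s : Fin n → Bool with weight s = k, (patternBound lam ε n s).1)
          / Real.sqrt (n.choose k) := by
    rw [← Finset.sum_fiberwise_of_maps_to (g := weight) (t := Finset.Icc 1 n)]
    · refine Finset.sum_congr rfl fun k hk => ?_
      rw [Finset.sum_div, Finset.filter_filter]
      refine Finset.sum_congr ?_ fun s hs => ?_
      · ext s
        have := (Finset.mem_Icc.mp hk).1
        simp only [Finset.mem_filter, Finset.mem_univ, true_and]
        omega
      · rw [(Finset.mem_filter.mp hs).2]
    · intro s hs
      have := (Finset.mem_filter.mp hs).2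
      exact Finset.mem_Icc.mpr ⟨by omega, weight_le s⟩
  rw [hfib]
  have hterm : ∀ k ∈ Finset.Icc 1 n,
      (∑ s : Fin n → Bool with weight s = k, (patternBound lam ε n s).1)
          / Real.sqrt (n.choose k) ≤ 16 * Real.exp 1 * ε * (1 / 2) ^ k := by
    intro k hk
    obtain ⟨hk1, hkn⟩ := Finset.mem_Icc.mp hk
    rcases eq_or_lt_of_le hk1 with rfl | hk2
    · rw [Finset.sum_eq_zero, zero_div]
      · positivity
      · intro s hs
        exact (patternBound_of_weight_le_one lam ε s).2 (Finset.mem_filter.mp hs).2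
    -- With `q = 4eε ≤ 1/4` and `k ≥ 2`, `q ^ (k/2) ≤ q * (1/2) ^ (k-2) = 16eε * (1/2) ^ k`.
    · have hc : (0 : ℝ) < n.choose k := by exact_mod_cast Nat.choose_pos hkn
      rw [div_le_iff₀ (Real.sqrt_pos.mpr hc)]
      refine abs_le_of_sq_le_sq' ?_ (by positivity) |>.2
      refine (sq_sum_patternBound_le hl hle hε h hk1 hkn).trans ?_
      rw [mul_pow _ (Real.sqrt _), Real.sq_sqrt hc.le]
      gcongr
      obtain ⟨j, rfl⟩ : ∃ j, k = j + 2 := ⟨k - 2, by omega⟩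
      set q := 4 * Real.exp 1 * ε with hq
      have hq0 : 0 < q := by positivity
      have h5 : q ^ j ≤ (1 / 4) ^ j := by gcongr
      have h6 : ((1 / 2 : ℝ) ^ (j + 2)) ^ 2 = (1 / 4) ^ j * (1 / 16) := by
        rw [← pow_mul, mul_comm, pow_mul, pow_add]; norm_num
      calc q ^ (j + 2) = q ^ j * q ^ 2 := pow_add _ _ _
        _ ≤ (1 / 4) ^ j * q ^ 2 := by gcongr
        _ = (16 * Real.exp 1 * ε * (1 / 2) ^ (j + 2)) ^ 2 := by
            rw [mul_pow _ ((1 / 2 : ℝ) ^ (j + 2)), h6, hq]; ring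
  refine (Finset.sum_le_sum hterm).trans ?_
  rw [← Finset.mul_sum]
  have hg : ∑ k ∈ Finset.Icc 1 n, (1 / 2 : ℝ) ^ k ≤ 2 := by
    refine le_trans (Finset.sum_le_sum_of_subset_of_nonneg (t := Finset.range (n + 1)) ?_ ?_)
      (sum_geometric_two_le (n + 1))
    · intro k hk
      have := Finset.mem_Icc.mp hk
      exact Finset.mem_range.mpr (by omega)
    · intros; positivity
  calc _ ≤ 16 * Real.exp 1 * ε * 2 := by gcongr
    _ = _ := by ring

/-! ### Means, Bessel's inequality and Minkowski's inequality -/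

/-- The mean of a function on a finite type. -/
noncomputable def mean {V : Type*} [Fintype V] (g : V → ℂ) : ℂ :=
  (1 / (Fintype.card V : ℂ)) * ∑ x, g x

section Mean

variable {V : Type*} [Fintype V]

theorem mean_add (g h : V → ℂ) : mean (fun x => g x + h x) = mean g + mean h := by
  simp [mean, Finset.sum_add_distrib, mul_add]

theorem mean_mul_const (g : V → ℂ) (c : ℂ) : mean (fun x => g x * c) = mean g * c := by
  simp [mean, ← Finset.sum_mul, mul_assoc]

theorem mean_const [Nonempty V] (c : ℂ) : mean (fun _ : V => c) = c := by
  simp [mean]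

theorem bessel_mean [Nonempty V] {ι : Type*} [Fintype ι] [DecidableEq ι] (a : ι → V → ℂ)
    (ha : ∀ i j, mean (fun x => conj (a i x) * a j x) = if i = j then 1 else 0) (w : V → ℂ) :
    (Fintype.card V : ℝ) * ∑ i, ‖mean (fun x => conj (a i x) * w x)‖ ^ 2
      ≤ ∑ x, ‖w x‖ ^ 2 := by
  have hV : (0 : ℝ) < Fintype.card V := by exact_mod_cast Fintype.card_pos
  set r : ℝ := Real.sqrt (Fintype.card V) with hr
  have hr0 : 0 < r := Real.sqrt_pos.mpr hV
  have hr2 : r * r = Fintype.card V := Real.mul_self_sqrt hV.le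
  have hr2c : (r : ℂ) * r = Fintype.card V := by exact_mod_cast hr2
  have hrc : (r : ℂ) ≠ 0 := by exact_mod_cast hr0.ne'
  let b : ι → EuclideanSpace ℂ V := fun i => WithLp.toLp 2 (fun x => (r : ℂ)⁻¹ * a i x)
  have hinner : ∀ i (v : V → ℂ), inner ℂ (b i) (WithLp.toLp 2 v)
      = r * mean (fun x => conj (a i x) * v x) := by
    intro i v
    simp only [b, mean, PiLp.inner_apply, RCLike.inner_apply, map_mul, map_inv₀, Complex.conj_ofReal]
    rw [← hr2c, Finset.mul_sum, Finset.mul_sum]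
    refine Finset.sum_congr rfl fun x _ => ?_
    field_simp
  have hb : Orthonormal ℂ b := by
    rw [orthonormal_iff_ite]
    intro i j
    have : b j = WithLp.toLp 2 (fun x => a j x * (r : ℂ)⁻¹) := by
      simp only [b, mul_comm]
    rw [this, hinner]
    simp only [← mul_assoc]
    rw [mean_mul_const, ha]
    split_ifs <;> simp [hrc]
  have := hb.sum_inner_products_le (WithLp.toLp 2 w) (s := Finset.univ)
  rw [EuclideanSpace.norm_sq_eq] at this
  refine le_trans (le_of_eq ?_) this
  rw [Finset.mul_sum]
  refine Finset.sum_congr rfl fun i _ => ?_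
  rw [hinner, norm_mul, mul_pow, Complex.norm_real, Real.norm_eq_abs, sq_abs, ← hr2, sq r]

end Mean

/-- Minkowski's inequality in squared form; `K` will be `|V|`, the normalization of the sums over
vertices. -/
theorem sum_norm_add_sq_le {ι : Type*} (s : Finset ι) (a b : ι → ℂ) {K X Y : ℝ} (hK : 0 ≤ K)
    (hX : 0 ≤ X) (hY : 0 ≤ Y) (ha : ∑ i ∈ s, ‖a i‖ ^ 2 ≤ K * X ^ 2)
    (hb : ∑ i ∈ s, ‖b i‖ ^ 2 ≤ K * Y ^ 2) :
    ∑ i ∈ s, ‖a i + b i‖ ^ 2 ≤ K * (X + Y) ^ 2 := by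
  have hcs : ∑ i ∈ s, ‖a i‖ * ‖b i‖ ≤ K * X * Y := by
    refine abs_le_of_sq_le_sq' ?_ (by positivity) |>.2
    refine (Finset.sum_mul_sq_le_sq_mul_sq s _ _).trans ?_
    calc _ ≤ (K * X ^ 2) * (K * Y ^ 2) :=
          mul_le_mul ha hb (Finset.sum_nonneg fun _ _ => by positivity) (by positivity)
      _ = _ := by ring
  calc ∑ i ∈ s, ‖a i + b i‖ ^ 2
      ≤ ∑ i ∈ s, (‖a i‖ ^ 2 + ‖b i‖ ^ 2 + 2 * (‖a i‖ * ‖b i‖)) := by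
        refine Finset.sum_le_sum fun i _ => ?_
        calc ‖a i + b i‖ ^ 2 ≤ (‖a i‖ + ‖b i‖) ^ 2 := by gcongr; exact norm_add_le _ _
          _ = _ := by ring
    _ = ∑ i ∈ s, ‖a i‖ ^ 2 + ∑ i ∈ s, ‖b i‖ ^ 2 + 2 * ∑ i ∈ s, ‖a i‖ * ‖b i‖ := by
        rw [Finset.sum_add_distrib, Finset.sum_add_distrib, Finset.mul_sum]
    _ ≤ _ := by nlinarith

/-! ### The spectral gap -/

namespace RegularGraph

variable {V : Type*} [Fintype V] (X : RegularGraph V)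

theorem sum_normAdj (x : V) : ∑ y, X.normAdj x y = 1 := by
  have h : (X.deg : ℂ) ≠ 0 := by exact_mod_cast X.deg_pos.ne'
  simp only [normAdj, ← Finset.sum_div]
  rw [div_eq_one_iff_eq h]
  exact_mod_cast X.regular x

theorem sum_normAdj_left (y : V) : ∑ x, X.normAdj x y = 1 := by
  rw [← X.sum_normAdj y]
  exact Finset.sum_congr rfl fun x _ => by simp [normAdj, X.symm x y]

theorem normAdj_mulVec_const (c : ℂ) : X.normAdj.mulVec (fun _ => c) = fun _ => c := by
  ext x
  simp [Matrix.mulVec, dotProduct, ← Finset.sum_mul, X.sum_normAdj x]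

theorem sum_normAdj_mulVec (g : V → ℂ) : ∑ x, X.normAdj.mulVec g x = ∑ x, g x := by
  simp only [Matrix.mulVec, dotProduct]
  rw [Finset.sum_comm]
  simp [← Finset.sum_mul, X.sum_normAdj_left]

theorem mean_normAdj_mulVec (g : V → ℂ) : mean (X.normAdj.mulVec g) = mean g := by
  simp [mean, X.sum_normAdj_mulVec]

/-- In an eigenbasis, removing the mean kills the top component and every other one shrinks by
`lam`. Since `lam < 1`, only the top eigenvalue can equal `1`, so the top eigenvector must span the
constants. -/
theorem IsExpander.sum_norm_sub_mean_sq_le [Nonempty V] {X : RegularGraph V} {lam : ℝ}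
    (hX : X.IsExpander lam) (h1 : lam < 1) (g : V → ℂ) :
    ∑ x, ‖X.normAdj.mulVec g x - mean g‖ ^ 2 ≤ lam ^ 2 * ∑ x, ‖g x‖ ^ 2 := by
  classical
  have hA := X.normAdj_isHermitian
  set b := hA.eigenvectorBasis with hb
  let eq : Fin (Fintype.card V) ≃ V := Fintype.equivOfCardEq (Fintype.card_fin _)
  let i₀ : V := eq ⟨0, Fintype.card_pos⟩
  have hev : ∀ i, i ≠ i₀ → |hA.eigenvalues i| ≤ lam := by
    intro i hi
    refine hX (eq.symm i) (Nat.pos_of_ne_zero fun h => hi ?_)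
    rw [← eq.symm_apply_eq]
    exact Fin.ext h
  have hcoef : ∀ (i : V) (v : V → ℂ), inner ℂ (b i) (WithLp.toLp 2 (X.normAdj.mulVec v))
      = (hA.eigenvalues i : ℂ) * inner ℂ (b i) (WithLp.toLp 2 v) := by
    intro i v
    have hsym := Matrix.isSymmetric_toEuclideanLin_iff.mpr hA
    have h : Matrix.toEuclideanLin X.normAdj (b i) = (hA.eigenvalues i : ℂ) • b i := by
      ext x
      exact congrFun (hA.mulVec_eigenvectorBasis i) x
    have h' := hsym (b i) (WithLp.toLp 2 v)
    rw [h, inner_smul_left, Complex.conj_ofReal] at h'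
    exact h'.symm
  -- Eigenvectors for different eigenvalues are orthogonal, and `1` has eigenvalue `1` while `b i`
  -- has one of modulus at most `lam < 1`.
  have hne : ∀ i, i ≠ i₀ → inner ℂ (b i) (WithLp.toLp 2 (fun _ => (1 : ℂ))) = 0 := by
    intro i hi
    have h := hcoef i (fun _ => 1)
    rw [X.normAdj_mulVec_const] at h
    have h2 : (1 - (hA.eigenvalues i : ℂ)) * inner ℂ (b i) (WithLp.toLp 2 (fun _ => (1 : ℂ))) = 0 := by
      rw [sub_mul, ← h, one_mul, sub_self]
    refine (mul_eq_zero.mp h2).resolve_left fun h3 => ?_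
    have h4 : (1 : ℝ) = hA.eigenvalues i := by exact_mod_cast sub_eq_zero.mp h3
    have h5 := (le_abs_self _).trans (hev i hi)
    linarith
  have hone : WithLp.toLp 2 (fun _ => (1 : ℂ))
      = inner ℂ (b i₀) (WithLp.toLp 2 (fun _ => (1 : ℂ))) • b i₀ := by
    conv_lhs => rw [← b.sum_repr (WithLp.toLp 2 (fun _ => (1 : ℂ)))]
    refine (Finset.sum_eq_single i₀ (fun i _ hi => ?_) (by simp)).trans ?_
    · rw [b.repr_apply_apply, hne i hi, zero_smul]
    · rw [b.repr_apply_apply]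
  have hc0 : inner ℂ (b i₀) (WithLp.toLp 2 (fun _ => (1 : ℂ))) ≠ 0 := by
    intro h
    rw [h, zero_smul] at hone
    obtain ⟨x⟩ := ‹Nonempty V›
    have := congrArg (fun v : EuclideanSpace ℂ V => v x) hone
    simp at this
  set v : V → ℂ := fun x => X.normAdj.mulVec g x - mean g with hv
  have hvsplit : WithLp.toLp 2 v = WithLp.toLp 2 (X.normAdj.mulVec g)
      - mean g • WithLp.toLp 2 (fun _ => (1 : ℂ)) := by
    ext x
    simp [hv]
  have hv0 : inner ℂ (b i₀) (WithLp.toLp 2 v) = 0 := by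
    have hV : (Fintype.card V : ℂ) ≠ 0 := by exact_mod_cast Fintype.card_ne_zero
    have hs : inner ℂ (WithLp.toLp 2 (fun _ => (1 : ℂ))) (WithLp.toLp 2 v) = 0 := by
      simp only [PiLp.inner_apply, RCLike.inner_apply, map_one, mul_one, hv,
        Finset.sum_sub_distrib, X.sum_normAdj_mulVec, mean, Finset.sum_const, Finset.card_univ,
        nsmul_eq_mul]
      field_simp
      simp
    rw [hone, inner_smul_left] at hs
    exact (mul_eq_zero.mp hs).resolve_left ((map_ne_zero _).mpr hc0)
  have hnv := b.sum_sq_norm_inner_right (WithLp.toLp 2 v)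
  have hng := b.sum_sq_norm_inner_right (WithLp.toLp 2 g)
  rw [EuclideanSpace.norm_sq_eq] at hnv hng
  change _ = ∑ x, ‖v x‖ ^ 2 at hnv
  change _ = ∑ x, ‖g x‖ ^ 2 at hng
  rw [← hnv, ← hng, Finset.mul_sum]
  refine Finset.sum_le_sum fun i _ => ?_
  by_cases hi : i = i₀
  · rw [hi, hv0]
    rw [norm_zero, zero_pow two_ne_zero]
    positivity
  · rw [hvsplit, inner_sub_right, inner_smul_right, hne i hi, mul_zero, sub_zero, hcoef, norm_mul,
      mul_pow, Complex.norm_real, Real.norm_eq_abs]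
    have := hev i hi
    gcongr

end RegularGraph

/-! ### The random walk along a pattern -/

section WalkVector

variable {κ : Type*}

/-- The pattern of the indices that are not `none`. -/
def supportPattern {n : ℕ} (α : Fin n → Option κ) : Fin n → Bool := fun i => (α i).isSome

@[simp] theorem supportPattern_cons {n : ℕ} (a : Option κ) (α : Fin n → Option κ) :
    supportPattern (Fin.cons a α : Fin (n + 1) → Option κ)
      = Fin.cons a.isSome (supportPattern α) := by
  ext i
  refine Fin.cases ?_ (fun i => ?_) i <;> simp [supportPattern]

theorem sum_supportPattern_cons_true [Fintype κ] {M : Type*} [AddCommMonoid M] {n : ℕ} (s : Fin n → Bool)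
    (F : (Fin (n + 1) → Option κ) → M) :
    ∑ α with supportPattern α = Fin.cons true s, F α
      = ∑ α with supportPattern α = s, ∑ j : κ, F (Fin.cons (some j) α) := by
  rw [Finset.sum_filter, sum_fin_succ_fun, Fintype.sum_option, Finset.sum_comm]
  simp [Finset.sum_filter, Fin.cons_inj]

theorem sum_supportPattern_cons_false [Fintype κ] {M : Type*} [AddCommMonoid M] {n : ℕ} (s : Fin n → Bool)
    (F : (Fin (n + 1) → Option κ) → M) :
    ∑ α with supportPattern α = Fin.cons false s, F α
      = ∑ α with supportPattern α = s, F (Fin.cons none α) := by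
  rw [Finset.sum_filter, sum_fin_succ_fun, Fintype.sum_option, Finset.sum_comm]
  simp [Finset.sum_filter, Fin.cons_inj]

/-- The vector obtained by alternately multiplying with the functions `e (α i)` and applying the
walk matrix, starting with the last index. -/
noncomputable def walkVector {V : Type*} [Fintype V] (X : RegularGraph V) (e : Option κ → V → ℂ) :
    (n : ℕ) → (Fin n → Option κ) → V → ℂ
  | 0, _ => fun _ => 1
  | n + 1, α => X.normAdj.mulVec (fun x => e (α 0) x * walkVector X e n (Fin.tail α) x)

variable {V : Type*} [Fintype V] (X : RegularGraph V)

theorem walkVector_cons (e : Option κ → V → ℂ) {n : ℕ} (a : Option κ) (α : Fin n → Option κ) :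
    walkVector X e (n + 1) (Fin.cons a α)
      = X.normAdj.mulVec (fun x => e a x * walkVector X e n α x) := by
  simp [walkVector]

theorem walkVector_none {e : Option κ → V → ℂ} (he : ∀ x, e none x = 1) (n : ℕ) :
    walkVector X e n (fun _ => none) = fun _ => 1 := by
  induction n with
  | zero => rfl
  | succ n ih =>
    have : (fun _ : Fin (n + 1) => (none : Option κ)) = Fin.cons none (fun _ => none) := by
      ext i : 1
      refine Fin.cases ?_ (fun i => ?_) i <;> simp
    rw [this, walkVector_cons, ih]
    simp only [he, mul_one]
    exact X.normAdj_mulVec_const 1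

/-- The bounds must hold summed over all `α` of one pattern, so that Bessel's inequality and the
pointwise bound on `∑ j, ‖e (some j) x‖ ^ 2` apply. The factor `d` is gained once: the initial
vector `1` lacks it, and it appears at the first non-constant factor. Hence the version of the mean
bound without `d`, the only one valid at weight zero, is carried along to drive the induction. -/
theorem walkVector_bound [Nonempty V] [Fintype κ] [DecidableEq κ] {e : Option κ → V → ℂ}
    (he : ∀ x, e none x = 1)
    (horth : ∀ i j, mean (fun x => conj (e i x) * e j x) = if i = j then 1 else 0)
    {N d lam : ℝ} (hN : 0 ≤ N) (hd : 0 ≤ d) (hd1 : d ≤ 1) (hlam : 0 ≤ lam)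
    (hsq : ∀ x, ∑ j : κ, ‖e (some j) x‖ ^ 2 ≤ N) (hcard : (Fintype.card κ : ℝ) ≤ N * d ^ 2)
    (hA : ∀ g : V → ℂ, ∑ x, ‖X.normAdj.mulVec g x - mean g‖ ^ 2 ≤ lam ^ 2 * ∑ x, ‖g x‖ ^ 2)
    {n : ℕ} (s : Fin n → Bool) :
    (∑ α with supportPattern α = s, ‖mean (walkVector X e n α)‖ ^ 2
        ≤ (patternBound lam (lam * Real.sqrt N) n s).1 ^ 2) ∧
      (weight s ≠ 0 → ∑ α with supportPattern α = s, ‖mean (walkVector X e n α)‖ ^ 2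
        ≤ (d * (patternBound lam (lam * Real.sqrt N) n s).1) ^ 2) ∧
      ∑ α with supportPattern α = s,
          ∑ x, ‖walkVector X e n α x - mean (walkVector X e n α)‖ ^ 2
        ≤ Fintype.card V * (d * (patternBound lam (lam * Real.sqrt N) n s).2) ^ 2 := by
  have hV : (0 : ℝ) < Fintype.card V := by exact_mod_cast Fintype.card_pos
  set ε := lam * Real.sqrt N with hε
  have hε0 : 0 ≤ ε := by positivity
  have hε2 : ε ^ 2 = lam ^ 2 * N := by rw [hε, mul_pow, Real.sq_sqrt hN]
  have hA' : ∀ g : V → ℂ, ∑ x, ‖X.normAdj.mulVec g x - mean g‖ ^ 2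
      ≤ lam ^ 2 * ∑ x, ‖g x - mean g‖ ^ 2 := by
    intro g
    refine le_trans (le_of_eq ?_) (hA (fun x => g x - mean g))
    have e1 : (fun x => g x - mean g) = g - fun _ => mean g := rfl
    have e2 : mean (fun x => g x - mean g) = 0 := by
      simpa [mean_const, sub_eq_add_neg] using mean_add g (fun _ => - mean g)
    rw [e2, e1, Matrix.mulVec_sub, X.normAdj_mulVec_const]
    simp
  induction n with
  | zero =>
    refine ⟨?_, ?_, ?_⟩
    · simp [walkVector, mean_const, Subsingleton.elim _ s]
    · simp [weight]
    · simp [walkVector, mean_const]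
  | succ n ih =>
    obtain ⟨h1, h2, h3⟩ := ih (Fin.tail s)
    obtain ⟨hp1, hp2⟩ := patternBound_nonneg hlam hε0 (Fin.tail s)
    rw [← Fin.cons_self_tail s]
    generalize Fin.tail s = s' at *
    cases s 0
    · simp only [sum_supportPattern_cons_false, walkVector_cons, he, one_mul, weight_cons,
        Bool.toNat_false, zero_add, patternBound_cons_false, X.mean_normAdj_mulVec]
      generalize patternBound lam ε n s' = p at *
      refine ⟨h1, h2, ?_⟩
      calc _ ≤ ∑ α with supportPattern α = s', lam ^ 2 *
            ∑ x, ‖walkVector X e n α x - mean (walkVector X e n α)‖ ^ 2 :=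
            Finset.sum_le_sum fun α _ => hA' _
        _ ≤ lam ^ 2 * (Fintype.card V * (d * p.2) ^ 2) := by
            rw [← Finset.mul_sum]; gcongr
        _ = _ := by ring
    · have hmean0 : ∀ j, mean (e (some j)) = 0 := by
        intro j
        simpa [he] using horth none (some j)
      simp only [sum_supportPattern_cons_true, walkVector_cons, weight_cons,
        Bool.toNat_true, patternBound_cons_true, X.mean_normAdj_mulVec]
      generalize patternBound lam ε n s' = p at *
      set u := walkVector X e n with hu
      have hsplit : ∀ j α x, e (some j) x * u α x
          = e (some j) x * mean (u α) + e (some j) x * (u α x - mean (u α)) := by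
        intros; ring
      -- The new mean only sees the old orthogonal part, since `e (some j)` has mean zero; Bessel
      -- then sums over `j` at no cost.
      have hmean : ∀ j α, mean (fun x => e (some j) x * u α x)
          = mean (fun x => conj (conj (e (some j) x)) * (u α x - mean (u α))) := by
        intro j α
        simp only [hsplit j α, Complex.conj_conj]
        rw [mean_add, mean_mul_const, hmean0, zero_mul, zero_add]
      have hbessel : ∀ α, (Fintype.card V : ℝ) * ∑ j, ‖mean (fun x => e (some j) x * u α x)‖ ^ 2
          ≤ ∑ x, ‖u α x - mean (u α)‖ ^ 2 := by
        intro α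
        simp only [hmean]
        refine bessel_mean (fun j x => conj (e (some j) x)) (fun i j => ?_) _
        have := horth (some j) (some i)
        simp only [Complex.conj_conj, Option.some_inj, eq_comm (a := j)] at this ⊢
        simpa only [mul_comm] using this
      have hconst : ∑ α with supportPattern α = s',
          ∑ j, ‖mean (fun x => e (some j) x * u α x)‖ ^ 2 ≤ (d * p.2) ^ 2 := by
        refine le_of_mul_le_mul_left ?_ hV
        rw [Finset.mul_sum]
        exact (Finset.sum_le_sum fun α _ => hbessel α).trans h3
      refine ⟨hconst.trans ?_, fun _ => hconst, ?_⟩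
      · gcongr
        exact mul_le_of_le_one_left hp2 hd1
      · set T := (Finset.univ.filter fun α : Fin n → Option κ => supportPattern α = s') ×ˢ
          ((Finset.univ : Finset κ) ×ˢ (Finset.univ : Finset V))
        let g₁ : (Fin n → Option κ) → κ → V → ℂ := fun α j x => e (some j) x * mean (u α)
        let g₂ : (Fin n → Option κ) → κ → V → ℂ :=
          fun α j x => e (some j) x * (u α x - mean (u α))
        have hT : ∀ F : (Fin n → Option κ) → κ → V → ℝ,
            ∑ t ∈ T, F t.1 t.2.1 t.2.2 = ∑ α with supportPattern α = s', ∑ j, ∑ x, F α j x := by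
          intro F
          simp only [T, Finset.sum_product]
        have hadd : ∀ α j x, X.normAdj.mulVec (fun x => e (some j) x * u α x) x
              - mean (fun x => e (some j) x * u α x)
            = (X.normAdj.mulVec (g₁ α j) x - mean (g₁ α j))
              + (X.normAdj.mulVec (g₂ α j) x - mean (g₂ α j)) := by
          intro α j x
          have : (fun x => e (some j) x * u α x) = g₁ α j + g₂ α j :=
            funext fun x => hsplit j α x
          have h' : mean (fun x => e (some j) x * u α x) = mean (g₁ α j) + mean (g₂ α j) := by
            rw [this]; exact mean_add _ _
          rw [h', this, Matrix.mulVec_add, Pi.add_apply]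
          ring
        have hone : ∀ j : κ, ∑ x, ‖e (some j) x‖ ^ 2 = (Fintype.card V : ℝ) := by
          intro j
          have := horth (some j) (some j)
          simp only [mean, if_true, ← Complex.normSq_eq_conj_mul_self] at this
          have hV' : (Fintype.card V : ℂ) ≠ 0 := by exact_mod_cast Fintype.card_ne_zero
          rw [one_div, inv_mul_eq_one₀ hV'] at this
          simp only [← Complex.normSq_eq_norm_sq]
          exact_mod_cast this.symm
        -- From the constant part, each unit-norm `e (some j)` costs the same, so their number `|κ|
        -- ≤ N * d ^ 2` enters and produces `d`.
        have hb₁ : ∑ t ∈ T, ‖X.normAdj.mulVec (g₁ t.1 t.2.1) t.2.2 - mean (g₁ t.1 t.2.1)‖ ^ 2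
            ≤ Fintype.card V * (d * (ε * p.1)) ^ 2 := by
          rw [hT (fun α j x => ‖X.normAdj.mulVec (g₁ α j) x - mean (g₁ α j)‖ ^ 2)]
          calc _ ≤ ∑ α with supportPattern α = s', ∑ j : κ,
                lam ^ 2 * (Fintype.card V * ‖mean (u α)‖ ^ 2) := by
                refine Finset.sum_le_sum fun α _ => Finset.sum_le_sum fun j _ => ?_
                refine (hA (g₁ α j)).trans (le_of_eq ?_)
                simp only [g₁, norm_mul, mul_pow, ← Finset.sum_mul, hone]
            _ = lam ^ 2 * Fintype.card V * (Fintype.card κ *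
                  ∑ α with supportPattern α = s', ‖mean (u α)‖ ^ 2) := by
                simp only [Finset.sum_const, Finset.card_univ, nsmul_eq_mul, Finset.mul_sum]
                exact Finset.sum_congr rfl fun _ _ => by ring
            _ ≤ lam ^ 2 * Fintype.card V * ((N * d ^ 2) * p.1 ^ 2) := by
                gcongr
            _ = Fintype.card V * (d ^ 2 * (lam ^ 2 * N) * p.1 ^ 2) := by ring
            _ = _ := by rw [← hε2]; ring
        -- From the orthogonal part, which already carries `d`, the pointwise bound `hsq` suffices.
        have hb₂ : ∑ t ∈ T, ‖X.normAdj.mulVec (g₂ t.1 t.2.1) t.2.2 - mean (g₂ t.1 t.2.1)‖ ^ 2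
            ≤ Fintype.card V * (d * (ε * p.2)) ^ 2 := by
          rw [hT (fun α j x => ‖X.normAdj.mulVec (g₂ α j) x - mean (g₂ α j)‖ ^ 2)]
          calc _ ≤ ∑ α with supportPattern α = s',
                lam ^ 2 * (N * ∑ x, ‖u α x - mean (u α)‖ ^ 2) := by
                refine Finset.sum_le_sum fun α _ => ?_
                refine (Finset.sum_le_sum fun j _ => hA (g₂ α j)).trans ?_
                rw [← Finset.mul_sum]
                refine mul_le_mul_of_nonneg_left ?_ (sq_nonneg _)
                rw [Finset.sum_comm, Finset.mul_sum]
                refine Finset.sum_le_sum fun x _ => ?_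
                simp only [g₂, norm_mul, mul_pow, ← Finset.sum_mul]
                gcongr
                exact hsq x
            _ = lam ^ 2 * N * ∑ α with supportPattern α = s',
                  ∑ x, ‖u α x - mean (u α)‖ ^ 2 := by
                rw [Finset.mul_sum]
                exact Finset.sum_congr rfl fun _ _ => by ring
            _ ≤ lam ^ 2 * N * (Fintype.card V * (d * p.2) ^ 2) := by gcongr
            _ = _ := by rw [← hε2]; ring
        have hfin := sum_norm_add_sq_le T _ _ hV.le (by positivity) (by positivity) hb₁ hb₂
        simp only [← hadd] at hfin
        rw [hT (fun α j x => ‖X.normAdj.mulVec (fun x => e (some j) x * u α x) x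
              - mean (fun x => e (some j) x * u α x)‖ ^ 2)] at hfin
        refine hfin.trans (le_of_eq ?_)
        ring

end WalkVector

/-! ### Quasirandom groups have few conjugacy classes -/

section Rep

variable {G : Type*} [Group G]

open scoped ComplexOrder MatrixOrder in
open Matrix in
/-- Every matrix representation of a finite group is conjugate to a unitary one. -/
theorem exists_unitary_conj [Fintype G] {d : ℕ} (R : G →* Matrix (Fin d) (Fin d) ℂ) :
    ∃ (B B' : Matrix (Fin d) (Fin d) ℂ) (ρ : G →* Matrix.unitaryGroup (Fin d) ℂ),
      B * B' = 1 ∧ B' * B = 1 ∧ ∀ g, (ρ g : Matrix (Fin d) (Fin d) ℂ) = B * R g * B' := by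
  classical
  -- The averaged, hence invariant, inner product; writing it as `Bᴴ * B` gives the change of basis.
  set H : Matrix (Fin d) (Fin d) ℂ := ∑ g, (R g)ᴴ * R g with hH
  have hinv : ∀ g, (R g)ᴴ * H * R g = H := by
    intro g
    rw [hH, Finset.mul_sum, Finset.sum_mul]
    refine Fintype.sum_equiv (Equiv.mulRight g) _ _ fun x => ?_
    simp [mul_assoc]
  have hpos : H.PosDef := by
    have h1 : H = 1 + ∑ g ∈ Finset.univ.erase (1 : G), (R g)ᴴ * R g := by
      rw [hH, ← Finset.add_sum_erase _ _ (Finset.mem_univ (1 : G))]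
      simp
    rw [h1]
    exact Matrix.PosDef.one.add_posSemidef
      (Matrix.posSemidef_sum _ fun g _ => Matrix.posSemidef_conjTranspose_mul_self _)
  obtain ⟨B, hB, hHB⟩ :=
    CStarAlgebra.isStrictlyPositive_iff_eq_star_mul_self.mp hpos.isStrictlyPositive
  rw [Matrix.star_eq_conjTranspose] at hHB
  have hBdet : IsUnit B.det := (Matrix.isUnit_iff_isUnit_det B).mp hB
  have h1 : B * B⁻¹ = 1 := Matrix.mul_nonsing_inv B hBdet
  have h2 : B⁻¹ * B = 1 := Matrix.nonsing_inv_mul B hBdet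
  have h3 : (B⁻¹)ᴴ * Bᴴ = 1 := by rw [← Matrix.conjTranspose_mul, h1, Matrix.conjTranspose_one]
  have hun : ∀ g, B * R g * B⁻¹ ∈ Matrix.unitaryGroup (Fin d) ℂ := by
    intro g
    rw [Matrix.mem_unitaryGroup_iff', Matrix.star_eq_conjTranspose]
    calc (B * R g * B⁻¹)ᴴ * (B * R g * B⁻¹)
        = (B⁻¹)ᴴ * ((R g)ᴴ * (Bᴴ * B) * R g) * B⁻¹ := by
          simp only [Matrix.conjTranspose_mul, mul_assoc]
      _ = ((B⁻¹)ᴴ * Bᴴ) * (B * B⁻¹) := by rw [← hHB, hinv, hHB]; simp only [mul_assoc]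
      _ = 1 := by rw [h1, h3, one_mul]
  refine ⟨B, B⁻¹, ⟨⟨fun g => ⟨B * R g * B⁻¹, hun g⟩, ?_⟩, ?_⟩, h1, h2, fun g => rfl⟩
  · apply Subtype.ext
    simp [h1]
  · intro g h
    apply Subtype.ext
    change B * R (g * h) * B⁻¹ = (B * R g * B⁻¹) * (B * R h * B⁻¹)
    calc B * R (g * h) * B⁻¹ = B * R g * 1 * R h * B⁻¹ := by simp [mul_assoc]
      _ = _ := by rw [← h2]; simp only [mul_assoc]

/-- An invariant subspace is then stable under all matrices, and a rank-one matrix carries a given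
non-zero vector to any other. -/
theorem isIrrep_of_span_eq_top {d : ℕ} [NeZero d] (ρ : G →* Matrix.unitaryGroup (Fin d) ℂ)
    (h : ∀ M, M ∈ Submodule.span ℂ
      (Set.range fun g => (ρ g : Matrix (Fin d) (Fin d) ℂ))) : IsIrrep ρ := by
  refine { exists_pair_ne := ⟨⊥, ⊤, fun hbt => ?_⟩, eq_bot_or_eq_top := fun W => ?_ }
  · have : (1 : Fin d → ℂ) ∈ (⊥ : Subrepresentation (toRep ρ)) := by
      rw [hbt]; exact Submodule.mem_top
    have h1 : (1 : Fin d → ℂ) = 0 := this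
    exact one_ne_zero h1
  · by_cases hW : W.toSubmodule = ⊥
    · exact Or.inl (Subrepresentation.toSubmodule_injective hW)
    · right
      apply Subrepresentation.toSubmodule_injective
      obtain ⟨v, hv, hv0⟩ := Submodule.exists_mem_ne_zero_of_ne_bot hW
      have hM : ∀ M : Matrix (Fin d) (Fin d) ℂ, M.mulVec v ∈ W.toSubmodule := by
        intro M
        induction h M using Submodule.span_induction with
        | mem x hx =>
          obtain ⟨g, rfl⟩ := hx
          exact W.apply_mem_toSubmodule g hv
        | zero => simp
        | add x y _ _ hx hy => rw [Matrix.add_mulVec]; exact add_mem hx hy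
        | smul a x _ hx => rw [Matrix.smul_mulVec]; exact Submodule.smul_mem _ _ hx
      obtain ⟨i, hi⟩ := Function.ne_iff.mp hv0
      have : W.toSubmodule = ⊤ := by
        refine eq_top_iff.mpr fun w _ => ?_
        have := hM (Matrix.vecMulVec w (Pi.single i (v i)⁻¹))
        rw [Matrix.vecMulVec_mulVec] at this
        simpa [inv_mul_cancel₀ hi] using this
      exact this

theorem IsQuasirandom.le_of_span_eq_top [Fintype G] {D : ℕ} (hG : IsQuasirandom G D) {d : ℕ}
    [NeZero d] (R : G →* Matrix (Fin d) (Fin d) ℂ)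
    (h : ∀ M, M ∈ Submodule.span ℂ (Set.range R)) (hR : R ≠ 1) : D ≤ d := by
  obtain ⟨B, B', ρ, h1, h2, hρ⟩ := exists_unitary_conj R
  refine hG d ρ (isIrrep_of_span_eq_top ρ fun M => ?_) fun h0 => hR ?_
  · have key : ∀ M ∈ Submodule.span ℂ (Set.range R), B * M * B' ∈ Submodule.span ℂ
        (Set.range fun g => (ρ g : Matrix (Fin d) (Fin d) ℂ)) := by
      intro M hM
      induction hM using Submodule.span_induction with
      | mem x hx =>
        obtain ⟨g, rfl⟩ := hx
        exact Submodule.subset_span ⟨g, hρ g⟩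
      | zero => simp
      | add x y _ _ hx hy => rw [mul_add, add_mul]; exact add_mem hx hy
      | smul a x _ hx =>
        rw [mul_smul_comm, smul_mul_assoc]; exact Submodule.smul_mem _ _ hx
    have := key _ (h (B' * M * B))
    have e : B * (B' * M * B) * B' = (B * B') * M * (B * B') := by simp only [mul_assoc]
    rwa [e, h1, one_mul, mul_one] at this
  · ext1 g
    have h3 : B * R g * B' = 1 := by rw [← hρ, h0]; rfl
    calc R g = (B' * B) * R g * (B' * B) := by rw [h2, one_mul, mul_one]
      _ = B' * (B * R g * B') * B := by simp only [mul_assoc]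
      _ = 1 := by rw [h3, mul_one, h2]

variable (G) in
/-- The class functions of sum zero. -/
def zeroSumClassFunctions [Fintype G] : Submodule ℂ (EuclideanSpace ℂ G) where
  carrier := {h | (∀ g x, h (g * x * g⁻¹) = h x) ∧ ∑ x, h x = 0}
  add_mem' := by
    rintro a b ⟨ha, ha'⟩ ⟨hb, hb'⟩
    exact ⟨fun g x => by simp [ha, hb], by simp [Finset.sum_add_distrib, ha', hb']⟩
  zero_mem' := by simp
  smul_mem' := by
    rintro c a ⟨ha, ha'⟩
    exact ⟨fun g x => by simp [ha], by simp [← Finset.mul_sum, ha']⟩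

theorem mem_zeroSumClassFunctions [Fintype G] {h : EuclideanSpace ℂ G} :
    h ∈ zeroSumClassFunctions G ↔ (∀ g x, h (g * x * g⁻¹) = h x) ∧ ∑ x, h x = 0 := Iff.rfl

/-- Decompose the group algebra into matrix blocks. A class function is central, so it acts as a
scalar on each block, and sum zero makes it vanish on trivial blocks. The dimension is thus at most
the number of non-trivial blocks; each has size at least `D`, and the squared sizes sum to `|G|`. -/
theorem IsQuasirandom.finrank_zeroSumClassFunctions_mul_sq_le [Fintype G] {D : ℕ}
    (hG : IsQuasirandom G D) :
    Module.finrank ℂ (zeroSumClassFunctions G) * D ^ 2 ≤ Fintype.card G := by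
  classical
  have : NeZero (Nat.card G : ℂ) := ⟨by exact_mod_cast Nat.card_pos.ne'⟩
  have : FiniteDimensional ℂ (MonoidAlgebra ℂ G) :=
    Module.Finite.of_basis (MonoidAlgebra.basis G ℂ)
  obtain ⟨k, d, hd, ⟨e⟩⟩ :=
    IsSemisimpleRing.exists_algEquiv_pi_matrix_of_isAlgClosed ℂ (MonoidAlgebra ℂ G)
  let R : ∀ i, G →* Matrix (Fin (d i)) (Fin (d i)) ℂ := fun i =>
    (Pi.evalMonoidHom (fun i => Matrix (Fin (d i)) (Fin (d i)) ℂ) i).comp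
      ((e : MonoidAlgebra ℂ G →* _).comp (MonoidAlgebra.of ℂ G))
  have hR : ∀ i g, R i g = e (MonoidAlgebra.single g 1) i := fun i g => rfl
  let L : (G → ℂ) → MonoidAlgebra ℂ G := (MonoidAlgebra.basis G ℂ).equivFun.symm
  have hL : ∀ h i, e (L h) i = ∑ g, h g • R i g := by
    intro h i
    have : L h = ∑ g, h g • MonoidAlgebra.single g (1 : ℂ) := by
      simp only [L, Module.Basis.equivFun_symm_apply, MonoidAlgebra.basis_apply]
    rw [this, map_sum, Finset.sum_apply]
    exact Finset.sum_congr rfl fun g _ => by rw [map_smul, Pi.smul_apply, hR]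
  have hspan : ∀ i M, M ∈ Submodule.span ℂ (Set.range (R i)) := by
    intro i M
    obtain ⟨a, ha⟩ := e.surjective (Pi.single i M)
    obtain ⟨h, rfl⟩ := (MonoidAlgebra.basis G ℂ).equivFun.symm.surjective a
    have h1 : M = ∑ g, h g • R i g := by
      rw [← hL]
      change M = e ((MonoidAlgebra.basis G ℂ).equivFun.symm h) i
      rw [ha, Pi.single_eq_same]
    rw [h1]
    exact Submodule.sum_mem _ fun g _ => Submodule.smul_mem _ _ (Submodule.subset_span ⟨g, rfl⟩)
  let ι := {i : Fin k // R i ≠ 1}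
  -- The `(0, 0)` entry recovers the scalar by which `h` acts on the block.
  let Φ : zeroSumClassFunctions G →ₗ[ℂ] (ι → ℂ) :=
    { toFun := fun h i => (∑ g, (h : EuclideanSpace ℂ G) g • R i g) 0 0
      map_add' := by
        intro h h'
        ext i
        simp [add_smul, Finset.sum_add_distrib, Matrix.add_apply]
      map_smul' := by
        intro c h
        ext i
        simp [mul_smul, ← Finset.smul_sum] }
  have hΦ : Function.Injective Φ := by
    rw [injective_iff_map_eq_zero]
    intro h hh
    obtain ⟨hclass, hsum⟩ := h.2
    have hzero : e (L (h : EuclideanSpace ℂ G).ofLp) = 0 := by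
      ext1 i
      rw [hL, Pi.zero_apply]
      by_cases hi : R i = 1
      · simp only [hi, MonoidHom.one_apply, ← Finset.sum_smul]
        rw [hsum, zero_smul]
      · set M := ∑ g, (h : EuclideanSpace ℂ G) g • R i g with hM
        have hcomm : ∀ g, Commute (R i g) M := by
          intro g
          change R i g * M = M * R i g
          rw [hM, Finset.mul_sum, Finset.sum_mul]
          refine Fintype.sum_equiv (MulAut.conj g).toEquiv _ _ fun x => ?_
          simp [hclass, ← map_mul]
        have hcomm' : ∀ P, Commute P M := by
          intro P
          induction hspan i P using Submodule.span_induction with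
          | mem x hx => obtain ⟨g, rfl⟩ := hx; exact hcomm g
          | zero => exact Commute.zero_left _
          | add x y _ _ hx hy => exact hx.add_left hy
          | smul a x _ hx => exact hx.smul_left a
        obtain ⟨c, hc⟩ := Matrix.mem_range_scalar_iff_commute_single'.mpr
          fun a b => hcomm' (Matrix.single a b 1)
        have h00 : M 0 0 = 0 := congrFun hh ⟨i, hi⟩
        rw [← hc] at h00 ⊢
        simp only [Matrix.scalar_apply, Matrix.diagonal_apply_eq] at h00
        rw [h00, map_zero]
    have h1 : L (h : EuclideanSpace ℂ G).ofLp = 0 := by simpa using hzero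
    have h2 : (h : EuclideanSpace ℂ G).ofLp = 0 := 
      (MonoidAlgebra.basis G ℂ).equivFun.symm.map_eq_zero_iff.mp h1
    apply Subtype.ext
    ext x
    exact congrFun h2 x
  have hrank : Module.finrank ℂ (zeroSumClassFunctions G) ≤ Fintype.card ι := by
    have := LinearMap.finrank_le_finrank_of_injective hΦ
    rwa [Module.finrank_fintype_fun_eq_card] at this
  have hcard : Fintype.card G = ∑ i, d i * d i := by
    have h1 := e.toLinearEquiv.finrank_eq
    rw [Module.finrank_eq_card_basis (MonoidAlgebra.basis G ℂ), Module.finrank_pi_fintype] at h1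
    simpa [Module.finrank_matrix] using h1
  calc Module.finrank ℂ (zeroSumClassFunctions G) * D ^ 2 ≤ Fintype.card ι * D ^ 2 := by gcongr
    _ = ∑ i : ι, D ^ 2 := by simp
    _ ≤ ∑ i : ι, d i * d i := by
        refine Finset.sum_le_sum fun i _ => ?_
        rw [sq]
        have := hd i.1
        have := hG.le_of_span_eq_top (R i) (hspan i) i.2
        exact Nat.mul_le_mul this this
    _ ≤ ∑ i, d i * d i := by
        rw [← Finset.sum_subtype (Finset.univ.filter fun i => R i ≠ 1) (by simp)
          (fun i => d i * d i)]
        exact Finset.sum_le_sum_of_subset (Finset.filter_subset _ _)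
    _ = Fintype.card G := hcard.symm

end Rep

/-! ### Fourier expansion of class functions -/

theorem mean_fin_succ {Ω : Type*} [Fintype Ω] {n : ℕ} (F : (Fin (n + 1) → Ω) → ℂ) :
    mean F = mean (fun a => mean (fun y : Fin n → Ω => F (Fin.cons a y))) := by
  simp only [mean, sum_fin_succ_fun, Fintype.card_pi_const, Finset.mul_sum, pow_succ',
    Nat.cast_mul, Nat.cast_pow]
  refine Finset.sum_congr rfl fun a _ => Finset.sum_congr rfl fun y _ => ?_
  rw [← mul_assoc, one_div_mul_one_div]

theorem mean_prod {Ω : Type*} [Fintype Ω] {n : ℕ} (a : Fin n → Ω → ℂ) :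
    mean (fun y : Fin n → Ω => ∏ i, a i (y i)) = ∏ i, mean (a i) := by
  induction n with
  | zero => simp [mean]
  | succ n ih =>
    rw [mean_fin_succ, Fin.prod_univ_succ]
    simp only [Fin.prod_univ_succ, Fin.cons_zero, Fin.cons_succ]
    rw [← ih (fun i => a i.succ), ← mean_mul_const]
    congr 1
    ext x
    rw [mul_comm, ← mean_mul_const]
    simp only [mul_comm]

section ClassBasis

variable {G : Type*} [Group G] [Fintype G]

/-- A basis of the class functions on `G`, orthonormal for the normalized inner product, whose
first member is the constant function `1`. -/
structure ClassBasis (G : Type*) [Group G] [Fintype G] (r : ℕ) where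
  /-- The members of the basis. -/
  toFun : Option (Fin r) → G → ℂ
  none_apply : ∀ x, toFun none x = 1
  orthonormal : ∀ i j, mean (fun x => conj (toFun i x) * toFun j x) = if i = j then 1 else 0
  expansion : ∀ h : G → ℂ, (∀ g x, h (g * x * g⁻¹) = h x) →
    ∀ x, h x = ∑ i, mean (fun y => conj (toFun i y) * h y) * toFun i x

/-- Adjoin the constant `1` to an orthonormal basis of the sum-zero class functions, rescaled by
`√|G|` to pass from the counting to the normalized inner product. -/
theorem exists_classBasis :
    Nonempty (ClassBasis G (Module.finrank ℂ (zeroSumClassFunctions G))) := by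
  set b := stdOrthonormalBasis ℂ (zeroSumClassFunctions G) with hb
  have hV : (0 : ℝ) < Fintype.card G := by exact_mod_cast Fintype.card_pos
  set r : ℝ := Real.sqrt (Fintype.card G) with hr
  have hr0 : 0 < r := Real.sqrt_pos.mpr hV
  have hr2 : (r : ℂ) * r = Fintype.card G := by exact_mod_cast Real.mul_self_sqrt hV.le
  have hrc : (r : ℂ) ≠ 0 := by exact_mod_cast hr0.ne'
  let β : Fin (Module.finrank ℂ (zeroSumClassFunctions G)) → G → ℂ :=
    fun j => (b j : EuclideanSpace ℂ G).ofLp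
  have hβ0 : ∀ j, ∑ x, β j x = 0 := fun j => (mem_zeroSumClassFunctions.mp (b j).2).2
  have hmean : ∀ j (h : G → ℂ), mean (fun x => conj ((r : ℂ) * β j x) * h x)
      = (r : ℂ)⁻¹ * ∑ x, conj (β j x) * h x := by
    intro j h
    simp only [mean, ← hr2, Finset.mul_sum, map_mul, Complex.conj_ofReal]
    refine Finset.sum_congr rfl fun x _ => ?_
    field_simp
  have hinner : ∀ i (z : zeroSumClassFunctions G),
      inner ℂ (b i) z = ∑ x, conj (β i x) * (z : EuclideanSpace ℂ G) x := by
    intro i z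
    simp only [Submodule.coe_inner, PiLp.inner_apply, RCLike.inner_apply, β, mul_comm]
  refine ⟨⟨fun i => i.elim (fun _ => 1) (fun j x => r * β j x), fun x => rfl, ?_, ?_⟩⟩
  · rintro (_ | i) (_ | j)
    · simp [mean]
    · simp [mean, ← Finset.mul_sum, hβ0]
    · simp [mean, ← Finset.mul_sum, ← map_sum, hβ0]
    · have h1 := hinner i (b j)
      rw [orthonormal_iff_ite.mp b.orthonormal] at h1
      have h2 : ∑ x, conj (β i x) * (r * β j x) = r * ∑ x, conj (β i x) * β j x := by
        rw [Finset.mul_sum]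
        exact Finset.sum_congr rfl fun x _ => by ring
      simp only [Option.elim, hmean, h2, Option.some_inj]
      rw [← mul_assoc, inv_mul_cancel₀ hrc, one_mul]
      exact h1.symm
  · intro h hh x
    have hz : WithLp.toLp 2 (fun x => h x - mean h) ∈ zeroSumClassFunctions G := by
      refine mem_zeroSumClassFunctions.mpr ⟨fun g x => by simp [hh], ?_⟩
      have hN : (Fintype.card G : ℂ) ≠ 0 := by exact_mod_cast Fintype.card_ne_zero
      simp [mean, Finset.sum_sub_distrib, hN]
    have hrepr := b.sum_repr ⟨_, hz⟩
    have hx := congrArg (fun z : zeroSumClassFunctions G => (z : EuclideanSpace ℂ G) x) hrepr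
    simp only [AddSubmonoidClass.coe_finsetSum, Submodule.coe_smul, WithLp.ofLp_sum,
      Finset.sum_apply, PiLp.smul_apply, smul_eq_mul, b.repr_apply_apply, hinner] at hx
    rw [Fintype.sum_option]
    simp only [Option.elim, map_one, one_mul, mul_one, hmean]
    rw [← sub_eq_iff_eq_add', ← hx]
    refine Finset.sum_congr rfl fun j _ => ?_
    have : ∑ y, conj (β j y) * (h y - mean h) = ∑ y, conj (β j y) * h y := by
      simp only [mul_sub, Finset.sum_sub_distrib, ← Finset.sum_mul, ← map_sum, hβ0]
      simp
    rw [this]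
    change _ * β j x = _
    field_simp

namespace ClassBasis

variable {r : ℕ} (e : ClassBasis G r)

/-- Bessel's inequality for the indicator function of `x`. -/
theorem sum_norm_sq_le (x : G) :
    ∑ j : Fin r, ‖e.toFun (some j) x‖ ^ 2 ≤ Fintype.card G := by
  classical
  have hV : (0 : ℝ) < Fintype.card G := by exact_mod_cast Fintype.card_pos
  have h := bessel_mean e.toFun e.orthonormal (Pi.single x 1)
  have h1 : ∀ i, mean (fun y => conj (e.toFun i y) * (Pi.single x 1 : G → ℂ) y)
      = (1 / (Fintype.card G : ℂ)) * conj (e.toFun i x) := by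
    intro i
    simp [mean, Pi.single_apply]
  have h2 : ∑ y, ‖(Pi.single x 1 : G → ℂ) y‖ ^ 2 = 1 := by
    rw [Finset.sum_eq_single x] <;> simp +contextual
  simp only [h1, h2, norm_mul, mul_pow, ← Finset.mul_sum, norm_div, norm_one, Complex.norm_natCast,
    RCLike.norm_conj, Fintype.sum_option] at h
  have h3 : (Fintype.card G : ℝ) * ((1 / Fintype.card G) ^ 2 *
      (‖e.toFun none x‖ ^ 2 + ∑ j : Fin r, ‖e.toFun (some j) x‖ ^ 2))
      = (‖e.toFun none x‖ ^ 2 + ∑ j : Fin r, ‖e.toFun (some j) x‖ ^ 2) / Fintype.card G := by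
    field_simp
  rw [h3, div_le_one hV] at h
  have := sq_nonneg ‖e.toFun none x‖
  linarith

/-- The tensor products of basis functions. -/
noncomputable def tensor {n : ℕ} (α : Fin n → Option (Fin r)) (y : Fin n → G) : ℂ :=
  ∏ i, e.toFun (α i) (y i)

/-- The coefficients of a function on `G^n` with respect to the tensor products. -/
noncomputable def coeff {n : ℕ} (f : (Fin n → G) → ℂ) (α : Fin n → Option (Fin r)) : ℂ :=
  mean (fun y => conj (e.tensor α y) * f y)

theorem tensor_orthonormal {n : ℕ} (α β : Fin n → Option (Fin r)) :
    mean (fun y => conj (e.tensor α y) * e.tensor β y) = if α = β then 1 else 0 := by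
  simp only [tensor, map_prod, ← Finset.prod_mul_distrib]
  rw [mean_prod (fun i x => conj (e.toFun (α i) x) * e.toFun (β i) x)]
  simp only [e.orthonormal, Finset.prod_ite_zero, Finset.prod_const_one, Finset.mem_univ,
    true_implies, funext_iff]

theorem sum_norm_coeff_sq_le {n : ℕ} (f : (Fin n → G) → ℂ) :
    ∑ α, ‖e.coeff f α‖ ^ 2 ≤ l2Norm f ^ 2 := by
  have hV : (0 : ℝ) < (Fintype.card G : ℝ) ^ n := by
    have : 0 < Fintype.card G := Fintype.card_pos
    positivity
  have h := bessel_mean e.tensor e.tensor_orthonormal f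
  rw [Fintype.card_pi_const, Nat.cast_pow] at h
  rw [l2Norm, Real.sq_sqrt (by positivity), one_div, ← div_eq_inv_mul, le_div_iff₀' hV]
  exact h

theorem coeff_comp_perm {n : ℕ} {f : (Fin n → G) → ℂ} (hf : IsSymmetricFunction f)
    (σ : Equiv.Perm (Fin n)) (α : Fin n → Option (Fin r)) :
    e.coeff f (α ∘ σ) = e.coeff f α := by
  simp only [coeff, mean]
  congr 1
  refine (Fintype.sum_equiv (Equiv.arrowCongr σ.symm (Equiv.refl G)) _ _ fun y => ?_).symm
  have h1 : (Equiv.arrowCongr σ.symm (Equiv.refl G)) y = y ∘ σ := by ext i; simp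
  rw [h1, hf]
  congr 2
  simp only [tensor, Function.comp_apply]
  exact (Equiv.prod_comp σ (fun i => e.toFun (α i) (y i))).symm

theorem tensor_cons {n : ℕ} (i : Option (Fin r)) (α : Fin n → Option (Fin r)) (a : G)
    (y : Fin n → G) : e.tensor (Fin.cons i α : Fin (n + 1) → Option (Fin r)) (Fin.cons a y)
      = e.toFun i a * e.tensor α y := by
  simp [tensor, Fin.prod_univ_succ]

/-- Conjugation acts independently in each coordinate, so the one-variable expansion applies one
coordinate at a time: the coefficients in the remaining variables are class functions of the first.
-/
theorem eq_sum_coeff_mul_tensor {n : ℕ} {f : (Fin n → G) → ℂ} (hf : IsClassFunction f)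
    (x : Fin n → G) : f x = ∑ α, e.coeff f α * e.tensor α x := by
  induction n with
  | zero =>
    simp [coeff, mean, tensor, Subsingleton.elim _ x]
  | succ n ih =>
    rw [← Fin.cons_self_tail x, sum_fin_succ_fun]
    generalize x 0 = a
    generalize Fin.tail x = y
    have hcons : ∀ (g : G) (g' : Fin n → G) (a : G) (y : Fin n → G),
        f (Fin.cons (g * a * g⁻¹) (fun i => g' i * y i * (g' i)⁻¹)) = f (Fin.cons a y) := by
      intro g g' a y
      rw [← hf (Fin.cons g g') (Fin.cons a y)]
      congr 1
      ext i
      refine Fin.cases ?_ (fun i => ?_) i <;> simp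
    have hF : ∀ a, IsClassFunction (fun y : Fin n → G => f (Fin.cons a y)) := by
      intro a g y
      simpa using hcons 1 g a y
    rw [ih (hF a) y, Finset.sum_comm]
    refine Finset.sum_congr rfl fun α _ => ?_
    rw [e.expansion (fun a => e.coeff (fun y => f (Fin.cons a y)) α) ?_ a, Finset.sum_mul]
    · refine Finset.sum_congr rfl fun i _ => ?_
      rw [tensor_cons, ← mul_assoc]
      congr 2
      rw [coeff, mean_fin_succ]
      simp only [tensor_cons, coeff, map_mul]
      congr 1
      ext b
      rw [mul_comm, ← mean_mul_const]
      congr 1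
      ext z
      ring
    · intro g b
      simp only [coeff]
      congr 1
      ext z
      have := hcons g 1 b z
      simp only [Pi.one_apply, one_mul, inv_one, mul_one] at this
      rw [this]

end ClassBasis

end ClassBasis

/-! ### Symmetric families of coefficients -/

theorem card_filter_weight_eq (n k : ℕ) :
    (Finset.univ.filter fun s : Fin n → Bool => weight s = k).card = n.choose k := by
  induction n generalizing k with
  | zero => cases k <;> simp [weight]
  | succ n ih =>
    simp only [Finset.card_filter] at ih ⊢
    rw [sum_fin_succ_fun, Fintype.sum_bool]
    simp only [weight_cons, Bool.toNat_true, Bool.toNat_false, zero_add]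
    rw [ih]
    cases k with
    | zero => simp
    | succ k =>
      rw [Nat.choose_succ_succ, ← ih k]
      congr 1
      refine Finset.sum_congr rfl fun s _ => ?_
      simp [add_comm 1]

theorem exists_perm_of_weight_eq {n : ℕ} {s t : Fin n → Bool} (h : weight s = weight t) :
    ∃ σ : Equiv.Perm (Fin n), s ∘ σ = t := by
  have hw : ∀ s : Fin n → Bool, weight s = Fintype.card {i // s i = true} := by
    intro s
    rw [Fintype.card_subtype, Finset.card_filter, weight]
    exact Finset.sum_congr rfl fun i _ => by cases s i <;> rfl
  rw [hw, hw] at h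
  let ε : {i // t i = true} ≃ {i // s i = true} := Fintype.equivOfCardEq h.symm
  refine ⟨ε.extendSubtype, funext fun i => ?_⟩
  by_cases hi : t i = true
  · rw [Function.comp_apply, hi]
    exact ε.extendSubtype_mem i hi
  · have := ε.extendSubtype_not_mem i hi
    simp only [Bool.not_eq_true] at this hi
    rw [Function.comp_apply, hi]
    exact this

/-- The `n.choose (weight s)` patterns of the same weight are permutations of one another, so they
carry equal mass. This is where symmetry of `f` pays. -/
theorem choose_mul_sum_supportPattern_le {κ : Type*} [Fintype κ] {n : ℕ}
    (F : (Fin n → Option κ) → ℝ) (h0 : ∀ α, 0 ≤ F α)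
    (hF : ∀ (σ : Equiv.Perm (Fin n)) α, F (α ∘ σ) = F α) (s : Fin n → Bool) :
    n.choose (weight s) * ∑ α with supportPattern α = s, F α ≤ ∑ α, F α := by
  have heq : ∀ t ∈ Finset.univ.filter (fun t : Fin n → Bool => weight t = weight s),
      ∑ α with supportPattern α = t, F α = ∑ α with supportPattern α = s, F α := by
    intro t ht
    obtain ⟨σ, rfl⟩ := exists_perm_of_weight_eq (Finset.mem_filter.mp ht).2.symm
    rw [Finset.sum_filter, Finset.sum_filter]
    refine (Fintype.sum_equiv (Equiv.arrowCongr σ.symm (Equiv.refl (Option κ))) _ _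
      fun α => ?_).symm
    have h1 : (Equiv.arrowCongr σ.symm (Equiv.refl (Option κ))) α = α ∘ σ := by ext i : 1; simp
    have h2 : supportPattern (α ∘ σ) = s ∘ σ ↔ supportPattern α = s :=
      σ.surjective.injective_comp_right.eq_iff (a := supportPattern α) (b := s)
    simp only [h1, h2, hF]
  calc n.choose (weight s) * ∑ α with supportPattern α = s, F α
      = ∑ t with weight t = weight s, ∑ α with supportPattern α = t, F α := by
        rw [Finset.sum_congr rfl heq, Finset.sum_const, card_filter_weight_eq, nsmul_eq_mul]
    _ ≤ ∑ t, ∑ α with supportPattern α = t, F α :=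
        Finset.sum_le_sum_of_subset_of_nonneg (Finset.subset_univ _)
          fun t _ _ => Finset.sum_nonneg fun α _ => h0 α
    _ = ∑ α, F α := Finset.sum_fiberwise _ _ _

/-! ### The walk error -/

section WalkError

variable {V κ : Type*} [Fintype V] (X : RegularGraph V)

theorem sum_walk_mul_prod_eq_walkVector (e : Option κ → V → ℂ) {n : ℕ}
    (α : Fin n → Option κ) (v : V) :
    ∑ y : Fin n → V,
        (∏ i : Fin n, X.normAdj ((Fin.cons v y : Fin (n + 1) → V) i.castSucc) (y i)) *
          ∏ i, e (α i) (y i)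
      = walkVector X e n α v := by
  induction n generalizing v with
  | zero => simp [walkVector]
  | succ n ih =>
    rw [← Fin.cons_self_tail α, walkVector_cons, sum_fin_succ_fun]
    simp only [Matrix.mulVec, dotProduct]
    refine Finset.sum_congr rfl fun w _ => ?_
    rw [← ih, Finset.mul_sum, Finset.mul_sum]
    refine Finset.sum_congr rfl fun y _ => ?_
    rw [Fin.prod_univ_succ, Fin.prod_univ_succ]
    simp only [Fin.cons_zero, Fin.cons_succ, Fin.castSucc_zero, ← Fin.succ_castSucc]
    ring

/-- `walkVector` applies the walk matrix `n` times, although the walk has only `n - 1` steps; the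
outermost application is harmless because it preserves means. -/
theorem sum_walkProb_mul_prod [Nonempty V] (e : Option κ → V → ℂ) {n : ℕ}
    (α : Fin n → Option κ) :
    ∑ x : Fin n → V, X.walkProb x * ∏ i, e (α i) (x i) = mean (walkVector X e n α) := by
  cases n with
  | zero => simp [walkVector, RegularGraph.walkProb, mean]
  | succ n =>
    rw [← Fin.cons_self_tail α, walkVector_cons, X.mean_normAdj_mulVec, sum_fin_succ_fun, mean,
      Finset.mul_sum]
    refine Finset.sum_congr rfl fun v _ => ?_
    rw [← sum_walk_mul_prod_eq_walkVector, Finset.mul_sum, Finset.mul_sum]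
    refine Finset.sum_congr rfl fun y _ => ?_
    rw [Fin.prod_univ_succ]
    simp only [RegularGraph.walkProb, Fin.cons_zero, Fin.cons_succ]
    ring

end WalkError

/-! ### From means over labels to means over vertices -/

section Unbiased

variable {G V : Type*} [Fintype G] [Fintype V]

theorem IsUnbiased.nonempty {φ : V → G} [Nonempty G] (hφ : IsUnbiased φ) : Nonempty V := by
  by_contra h
  rw [not_nonempty_iff] at h
  have := hφ (Classical.arbitrary G)
  have hG : (Fintype.card G : ℝ) ≠ 0 := by exact_mod_cast Fintype.card_ne_zero
  simp only [Fintype.card_eq_zero, Nat.cast_zero, div_zero] at this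
  exact one_div_ne_zero hG this.symm

theorem IsUnbiased.mean_comp {φ : V → G} (hφ : IsUnbiased φ) (h : G → ℂ) :
    mean (fun v => h (φ v)) = mean h := by
  classical
  rw [mean, mean, ← Finset.sum_fiberwise Finset.univ φ, Finset.mul_sum, Finset.mul_sum]
  refine Finset.sum_congr rfl fun g _ => ?_
  have h1 : ∑ v with φ v = g, h (φ v) = Nat.card {v : V // φ v = g} * h g := by
    rw [Finset.sum_congr rfl fun v hv => by rw [(Finset.mem_filter.mp hv).2], Finset.sum_const,
      nsmul_eq_mul, Nat.card_eq_fintype_card, Fintype.card_subtype]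
  have h2 : (Nat.card {v : V // φ v = g} : ℂ) / Fintype.card V = 1 / Fintype.card G := by
    simpa using congrArg Complex.ofReal (hφ g)
  rw [h1, ← h2]
  ring

end Unbiased

/-- The error bound for symmetric class functions of the labels along an expander walk; it only
uses that the labeling is unbiased. -/
theorem norm_walkError_le {G V : Type*} [Group G] [Fintype G] [Fintype V] (X : RegularGraph V)
    (φ : V → G) {D n : ℕ} {lam : ℝ} {f : (Fin n → G) → ℂ} (hD : 1 ≤ D)
    (hG : IsQuasirandom G D) (hφ : IsUnbiased φ) (hlam : 0 ≤ lam) (hX : X.IsExpander lam)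
    (hsmall : lam * Real.sqrt (Fintype.card G) ≤ 1 / (16 * Real.exp 1))
    (hclass : IsClassFunction f) (hsymm : IsSymmetricFunction f) :
    ‖X.walkError (fun x => f (φ ∘ x))‖
      ≤ 32 * Real.exp 1 * (Real.sqrt (Fintype.card G) / D * lam) * l2Norm f := by
  have : Nonempty V := hφ.nonempty
  obtain ⟨e⟩ := exists_classBasis (G := G)
  have hrank := hG.finrank_zeroSumClassFunctions_mul_sq_le
  set r := Module.finrank ℂ (zeroSumClassFunctions G)
  set N : ℝ := ((Fintype.card G : ℕ) : ℝ) with hN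
  have hN1 : 1 ≤ N := by rw [hN]; exact_mod_cast Fintype.card_pos (α := G)
  have hsq1 : 1 ≤ Real.sqrt N := Real.one_le_sqrt.mpr hN1
  have hle : lam ≤ lam * Real.sqrt N := le_mul_of_one_le_right hlam hsq1
  have hD0 : (0 : ℝ) < D := by exact_mod_cast hD
  have hlam1 : lam < 1 := by
    refine (hle.trans hsmall).trans_lt ?_
    have := Real.add_one_le_exp (1 : ℝ)
    rw [div_lt_one (by positivity)]
    linarith
  let ê : Option (Fin r) → V → ℂ := fun i v => e.toFun i (φ v)
  have horth : ∀ i j, mean (fun x => conj (ê i x) * ê j x) = if i = j then 1 else 0 := fun i j =>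
    (hφ.mean_comp fun g => conj (e.toFun i g) * e.toFun j g).trans (e.orthonormal i j)
  -- Taking `N = |G|` and `d = 1 / D`, the hypothesis `|κ| ≤ N * d ^ 2` is the dimension bound
  -- `hrank`.
  have hwalk := fun s : Fin n → Bool => walkVector_bound X (e := ê) (fun x => e.none_apply _) horth
    (N := N) (d := 1 / D) (lam := lam) (by linarith) (by positivity)
    ((div_le_one hD0).mpr (by exact_mod_cast hD)) hlam (fun x => e.sum_norm_sq_le _)
    (by
      rw [Fintype.card_fin, one_div, inv_pow, ← div_eq_mul_inv, le_div_iff₀ (by positivity)]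
      rw [hN]
      exact_mod_cast hrank)
    (hX.sum_norm_sub_mean_sq_le hlam1) s
  set W : (Fin n → Option (Fin r)) → ℂ := fun α => mean (walkVector X ê n α) with hW
  have hf : ∀ x : Fin n → V, f (φ ∘ x) = ∑ α, e.coeff f α * ∏ i, ê (α i) (x i) := fun x =>
    e.eq_sum_coeff_mul_tensor hclass _
  have hmean : ∀ α : Fin n → Option (Fin r),
      (1 / (Fintype.card V : ℂ) ^ n) * ∑ x : Fin n → V, ∏ i, ê (α i) (x i)
        = if weight (supportPattern α) = 0 then 1 else 0 := by
    intro α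
    have h1 := mean_prod (fun i => ê (α i))
    rw [mean, Fintype.card_pi_const, Nat.cast_pow] at h1
    have h2 : ∀ i, mean (ê i) = if none = i then 1 else 0 := by
      intro i
      have h3 : ∀ x, ê none x = 1 := fun x => e.none_apply _
      simpa [h3] using horth none i
    rw [h1]
    simp only [h2, Finset.prod_ite_zero, Finset.prod_const_one, Finset.mem_univ, true_implies]
    refine if_congr ?_ rfl rfl
    simp only [weight, Finset.sum_eq_zero_iff, Finset.mem_univ, true_implies, supportPattern]
    refine forall_congr' fun i => ?_
    cases α i <;> simp
  have herr : X.walkError (fun x => f (φ ∘ x))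
      = ∑ s : Fin n → Bool with weight s ≠ 0, ∑ α with supportPattern α = s,
          e.coeff f α * W α := by
    have h1 : X.walkError (fun x => f (φ ∘ x)) = ∑ α, e.coeff f α *
        (W α - if weight (supportPattern α) = 0 then 1 else 0) := by
      simp only [RegularGraph.walkError, hf, mul_sub, Finset.sum_sub_distrib, ← hmean,
        hW, ← sum_walkProb_mul_prod, Finset.mul_sum]
      congr 1
      · rw [Finset.sum_comm]
        exact Finset.sum_congr rfl fun α _ => Finset.sum_congr rfl fun x _ => by ring
      · rw [Finset.sum_comm]
        exact Finset.sum_congr rfl fun α _ => Finset.sum_congr rfl fun x _ => by ring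
    rw [h1, ← Finset.sum_fiberwise Finset.univ supportPattern, Finset.sum_filter]
    refine Finset.sum_congr rfl fun s _ => ?_
    split_ifs with hs
    · refine Finset.sum_congr rfl fun α hα => ?_
      rw [(Finset.mem_filter.mp hα).2, if_neg hs, sub_zero]
    -- At weight zero every factor is constant, and both distributions give mean `1`.
    · refine Finset.sum_eq_zero fun α hα => ?_
      rw [not_not] at hs
      have hα' := (Finset.mem_filter.mp hα).2
      have hnone : α = fun _ => none := by
        rw [← hα'] at hs
        simp only [weight, Finset.sum_eq_zero_iff, Finset.mem_univ, true_implies,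
          supportPattern] at hs
        funext i
        have := hs i
        cases h : α i
        · rfl
        · simp [h] at this
      rw [hα', if_pos hs, hnone, hW]
      simp only
      rw [walkVector_none X (fun x => e.none_apply _), mean_const, sub_self, mul_zero]
  have hterm : ∀ s : Fin n → Bool, weight s ≠ 0 →
      ‖∑ α with supportPattern α = s, e.coeff f α * W α‖
        ≤ 1 / D * l2Norm f * ((patternBound lam (lam * Real.sqrt N) n s).1 /
            Real.sqrt (n.choose (weight s))) := by
    intro s hs
    have hp := (patternBound_nonneg hlam (hlam.trans hle) s).1
    have hl2 : 0 ≤ l2Norm f := Real.sqrt_nonneg _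
    have hc : (0 : ℝ) < n.choose (weight s) := by exact_mod_cast Nat.choose_pos (weight_le s)
    have hcoef : ∑ α with supportPattern α = s, ‖e.coeff f α‖ ^ 2
        ≤ l2Norm f ^ 2 / n.choose (weight s) := by
      rw [le_div_iff₀' hc]
      refine (choose_mul_sum_supportPattern_le (fun α => ‖e.coeff f α‖ ^ 2)
        (fun _ => by positivity) (fun σ α => ?_) s).trans (e.sum_norm_coeff_sq_le f)
      rw [e.coeff_comp_perm hsymm]
    refine (norm_sum_le _ _).trans ?_
    simp only [norm_mul]
    -- Cauchy-Schwarz within one pattern; non-zero weight permits the walk bound that includes `1 /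
    -- D`.
    refine abs_le_of_sq_le_sq' ?_ (by positivity) |>.2
    refine (Finset.sum_mul_sq_le_sq_mul_sq _ _ _).trans ?_
    refine (mul_le_mul hcoef ((hwalk s).2.1 hs) (Finset.sum_nonneg fun _ _ => by positivity)
      (by positivity)).trans (le_of_eq ?_)
    rw [mul_pow, mul_pow, div_pow _ (Real.sqrt _), Real.sq_sqrt hc.le]
    ring
  rw [herr]
  calc _ ≤ ∑ s : Fin n → Bool with weight s ≠ 0, 1 / D * l2Norm f *
        ((patternBound lam (lam * Real.sqrt N) n s).1 / Real.sqrt (n.choose (weight s))) :=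
        (norm_sum_le _ _).trans
          (Finset.sum_le_sum fun s hs => hterm s (Finset.mem_filter.mp hs).2)
    _ ≤ 1 / D * l2Norm f * (32 * Real.exp 1 * (lam * Real.sqrt N)) := by
        rw [← Finset.mul_sum]
        refine mul_le_mul_of_nonneg_left
          (sum_patternBound_div_sqrt_choose_le hlam hle hsmall n) ?_
        have : 0 ≤ l2Norm f := Real.sqrt_nonneg _
        positivity
    _ = _ := by ring

/-! ### Specialization to abelian groups and to the identity labeling -/

section Abelian

variable {G : Type*}

theorem IsIrrep.dim_pos [Group G] {d : ℕ} {ρ : G →* Matrix.unitaryGroup (Fin d) ℂ}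
    (h : IsIrrep ρ) : 1 ≤ d := by
  rcases d with _ | d
  · obtain ⟨W, W', hne⟩ := h.exists_pair_ne
    exact absurd (Subrepresentation.toSubmodule_injective (Subsingleton.elim _ _)) hne
  · omega

/-- Lets the abelian bounds follow from the general one with `D = 1`. -/
theorem isQuasirandom_one [Group G] : IsQuasirandom G 1 := fun _ _ h _ => h.dim_pos

theorem isClassFunction_of_comm [CommGroup G] {n : ℕ} (f : (Fin n → G) → ℂ) :
    IsClassFunction f := fun g x => by simp

theorem isUnbiased_id [Fintype G] : IsUnbiased (id : G → G) := fun g => by simp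

end Abelian

end ExpanderWalk

theorem proposition5p5 :
    ∃ C : ℝ, 0 < C ∧
      -- quasirandom groups and pseudo-Cayley expanders
      (∀ (G : Type u) [Group G] [Fintype G] (V : Type v) [Fintype V]
        (X : RegularGraph V) (φ : V → G) (D n : ℕ) (lam : ℝ) (f : (Fin n → G) → ℂ),
        1 ≤ D → IsQuasirandom G D → IsPseudoCayley X φ →
        0 ≤ lam → X.IsExpander lam →
        lam * Real.sqrt (Fintype.card G) ≤ 1 / (16 * Real.exp 1) →
        IsClassFunction f → IsSymmetricFunction f →
        ‖X.walkError (fun x => f (φ ∘ x))‖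
          ≤ C * (Real.sqrt (Fintype.card G) / D * lam) * l2Norm f) ∧
      -- abelian groups and pseudo-Cayley expanders
      (∀ (G : Type u) [CommGroup G] [Fintype G] (V : Type v) [Fintype V]
        (X : RegularGraph V) (φ : V → G) (n : ℕ) (lam : ℝ) (f : (Fin n → G) → ℂ),
        IsPseudoCayley X φ →
        0 ≤ lam → X.IsExpander lam →
        lam * Real.sqrt (Fintype.card G) ≤ 1 / (16 * Real.exp 1) →
        IsSymmetricFunction f →
        ‖X.walkError (fun x => f (φ ∘ x))‖
          ≤ C * (Real.sqrt (Fintype.card G) * lam) * l2Norm f) ∧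
      -- abelian groups and Cayley expanders
      (∀ (G : Type u) [CommGroup G] [Fintype G] (S : Multiset G) (hS : S ≠ 0)
        (hinv : S.map (fun s => s⁻¹) = S) (n : ℕ) (lam : ℝ) (f : (Fin n → G) → ℂ),
        0 ≤ lam → (cayley S hS hinv).IsExpander lam →
        lam * Real.sqrt (Fintype.card G) ≤ 1 / (16 * Real.exp 1) →
        IsSymmetricFunction f →
        ‖(cayley S hS hinv).walkError f‖
          ≤ C * (Real.sqrt (Fintype.card G) * lam) * l2Norm f) := by
  refine ⟨32 * Real.exp 1, by positivity, ?_, ?_, ?_⟩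
  · intro G _ _ V _ X φ D n lam f hD hG hX hlam hexp hsmall hclass hsymm
    exact norm_walkError_le X φ hD hG hX.1 hlam hexp hsmall hclass hsymm
  · intro G _ _ V _ X φ n lam f hX hlam hexp hsmall hsymm
    simpa using norm_walkError_le X φ le_rfl isQuasirandom_one hX.1 hlam hexp hsmall
      (isClassFunction_of_comm f) hsymm
  · intro G _ _ S hS hinv n lam f hlam hexp hsmall hsymm
    simpa using norm_walkError_le (cayley S hS hinv) id le_rfl isQuasirandom_one isUnbiased_id
      hlam hexp hsmall (isClassFunction_of_comm f) hsymm
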